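/- For $(a,c)\in\mathbb{C}^2$ with $a\neq 0$ let $H_{a,c}:\mathbb{C}^2\to\mathbb{C}^2$, $H_{a,c}(x,y)=(x^2+c-ay,\,x)$, be the complex Hénon map, let $K^{\mathbb{C}}_{a,c}=\{p\in\mathbb{C}^2 : \{H_{a,c}^n(p)\}_{n\in\mathbb{Z}}\text{ is bounded}\}$, and, for real $a,c$, let $K^{\mathbb{R}}_{a,c}=K^{\mathbb{C}}_{a,c}\cap\mathbb{R}^2$. Let $\sigma$ be the shift $(\sigma s)_i=s_{i+1}$ on $\Sigma_2=\{0,1\}^{\mathbb{Z}}$. Let $\mathcal{H}^{\mathbb{C}}$ be the set of all $(a,c)\in\mathbb{C}^2$ with $a\ne0$ such that $K^{\mathbb{C}}_{a,c}$ is a uniformly hyperbolic invariant set of $H_{a,c}$ and $H_{a,c}|_{K^{\mathbb{C}}_{a,c}}$ is topologically conjugate to $\sigma$. Let $\mathcal{H}^{\mathbb{C}}_0$ be the connected component of $\mathcal{H}^{\mathbb{C}}$ that contains $\mathrm{HOV}=\{(a,c)\in\mathbb{C}^2 : |c|>2(|a|+1)^2,\ a\neq0\}$, and let $\mathrm{DN}=\{(a,c)\in\mathbb{R}^2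 : c<-(5+2\sqrt5)(|a|+1)^2/4,\ a\ne0\}$. For a loop $\gamma:[0,1]\to\mathcal{H}^{\mathbb{C}}_0$ based at a point $(a_0,c_0)\in\mathrm{DN}$ and a topological conjugacy $h_0:K^{\mathbb{C}}_{a_0,c_0}\to\Sigma_2$ (from $H_{a_0,c_0}$ to $\sigma$), let $h_t:K^{\mathbb{C}}_{\gamma(t)}\to\Sigma_2$, $t\in[0,1]$, denote the continuation of $h_0$ along $\gamma$, that is, the family of topological conjugacies from $H_{\gamma(t)}$ to $\sigma$ that starts at $h_0$ and is continuous in the sense that $(t,s)\mapsto h_t^{-1}(s)\in\mathbb{C}^2$ is continuous on $[0,1]\times\Sigma_2$; and put $\rho(\gamma)=h_1\circ h_0^{-1}:\Sigma_2\to\Sigma_2$. Theorem. Let $(a,c)\in\mathcal{H}^{\mathbb{C}}_0\cap\mathbb{R}^2$ and $(a_0,c_0)\in\mathrm{DN}$. (1) There exists a loop $\gamma:[0,1]\to\mathcal{H}^{\mathbb{C}}_0$ based at $(a_0,c_0)$ with $\gamma(1/2)=(a,c)$ such that, for every conjugacy $h_0:K^{\mathbb{C}}_{a_0,c_0}\to\Sigma_2$,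 the continuation $(h_t)$ of $h_0$ along $\gamma$ exists and is unique, and $H_{a,c}:K^{\mathbb{R}}_{a,c}\to K^{\mathbb{R}}_{a,c}$ is topologically conjugate to $\sigma|_{\operatorname{Fix}(\rho(\gamma))}:\operatorname{Fix}(\rho(\gamma))\to\operatorname{Fix}(\rho(\gamma))$. (2) In fact, let $\alpha$ be any path in $\mathcal{H}^{\mathbb{C}}_0$ from $(a_0,c_0)$ to $(a,c)$, and let $\gamma=\bar\alpha^{-1}\cdot\alpha$ be the concatenation that runs first through $\alpha$ (for $t\le1/2$) and then through the complex conjugate path $\bar\alpha$ backwards. Then $\gamma$ is a loop in $\mathcal{H}^{\mathbb{C}}_0$ with $\gamma(1/2)=(a,c)$ and, for every conjugacy $h_0:K^{\mathbb{C}}_{a_0,c_0}\to\Sigma_2$, the continuation $(h_t)$ of $h_0$ along $\gamma$ exists and is unique, and $h_{1/2}$ restricts to a homeomorphism $K^{\mathbb{R}}_{a,c}\to\operatorname{Fix}(\rho(\gamma))$ that conjugates $H_{a,c}|_{K^{\mathbb{R}}_{a,c}}$ to $\sigma|_{\operatorname{Fix}(\rho(\gamma))}$. -/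

import Mathlib

open Set unitInterval

namespace HenonMonodromy

/-! ### The Hénon map -/

/-- The Hénon map `(x, y) ↦ (x ^ 2 + c - a * y, x)` with parameter `p = (a, c)`, over a field
(used below for `ℂ` and for `ℝ`). -/
noncomputable def henon {F : Type*} [Field F] (p : F × F) (z : F × F) : F × F :=
  (z.1 ^ 2 + p.2 - p.1 * z.2, z.1)

/-- For `a ≠ 0` the Hénon map is a bijection with polynomial inverse. -/
noncomputable def henonPerm {F : Type*} [Field F] (p : F × F) (hp : p.1 ≠ 0) : Equiv.Perm (F × F) where
  toFun := henon p
  invFun := fun z => (z.2, (z.2 ^ 2 + p.2 - z.1) / p.1)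
  left_inv := fun z => by
    refine Prod.ext rfl ?_
    simp only [henon]
    field_simp
    ring
  right_inv := fun z => by
    refine Prod.ext ?_ rfl
    simp only [henon]
    field_simp
    ring

/-- The set `K^ℂ_{a,c}` of the points of `ℂ²` whose full orbit `{H ^ n z : n ∈ ℤ}` is bounded.
Two-sided orbits make sense for `a ≠ 0`; the set is empty for `a = 0`. -/
def K (p : ℂ × ℂ) : Set (ℂ × ℂ) :=
  {z | ∃ hp : p.1 ≠ 0, Bornology.IsBounded (range fun n : ℤ => (henonPerm p hp ^ n) z)}

theorem henon_mem_K (p : ℂ × ℂ) : MapsTo (henon p) (K p) (K p) := by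
  rintro z ⟨hp, hz⟩
  refine ⟨hp, hz.subset ?_⟩
  rintro _ ⟨n, rfl⟩
  refine ⟨n + 1, ?_⟩
  change (henonPerm p hp ^ (n + 1)) z = (henonPerm p hp ^ n) (henonPerm p hp z)
  rw [zpow_add_one]
  rfl

/-- The restriction `H_{a,c} : K^ℂ_{a,c} → K^ℂ_{a,c}`. -/
noncomputable def henonK (p : ℂ × ℂ) : K p → K p := (henon_mem_K p).restrict

/-- The inclusion `ℝ² ⊂ ℂ²`. -/
def toComplex (q : ℝ × ℝ) : ℂ × ℂ := ((q.1 : ℂ), (q.2 : ℂ))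

/-- The set `K^ℝ_{a,c} = K^ℂ_{a,c} ∩ ℝ²`, as a subset of `ℝ²`. -/
def realK (p : ℝ × ℝ) : Set (ℝ × ℝ) := {z | toComplex z ∈ K (toComplex p)}

theorem toComplex_henon (p z : ℝ × ℝ) :
    toComplex (henon p z) = henon (toComplex p) (toComplex z) := by
  simp [toComplex, henon]

theorem henon_mem_realK (p : ℝ × ℝ) : MapsTo (henon p) (realK p) (realK p) := by
  intro z hz
  change toComplex (henon p z) ∈ K (toComplex p)
  rw [toComplex_henon]
  exact henon_mem_K _ hz

/-- The restriction `H_{a,c} : K^ℝ_{a,c} → K^ℝ_{a,c}` of the real Hénon map. -/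
noncomputable def henonRealK (p : ℝ × ℝ) : realK p → realK p := (henon_mem_realK p).restrict

/-! ### The full shift on two symbols -/

/-- The space `Σ₂ = {0, 1} ^ ℤ` of bi-infinite sequences, with the product topology. -/
abbrev Sigma2 : Type := ℤ → Fin 2

/-- The shift map on `Σ₂`. -/
def shift (s : Sigma2) : Sigma2 := fun i => s (i + 1)

/-! ### Uniform hyperbolicity -/

/-- `f` is uniformly hyperbolic on the invariant set `Λ`. The continuous splitting
`E^s ⊕ E^u` of the tangent bundle over `Λ` into two invariant subbundles is given by the
continuous field `P` of projections onto `E^s` along `E^u`: `E^s` at `z` is the range of `P z`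
(the vectors fixed by `P z`) and `E^u` is its kernel. Derivatives of forward iterates contract
`E^s`, and those of backward iterates contract `E^u`, exponentially. -/
def IsUniformlyHyperbolicOn {E : Type*} [NormedAddCommGroup E] [NormedSpace ℂ E]
    (f : Equiv.Perm E) (Λ : Set E) : Prop :=
  ∃ P : E → E →L[ℂ] E,
    ContinuousOn P Λ ∧
    (∀ z ∈ Λ, ∀ v, P z (P z v) = P z v) ∧
    (∀ z ∈ Λ, ∀ v, fderiv ℂ f z (P z v) = P (f z) (fderiv ℂ f z v)) ∧
    ∃ C : ℝ, 0 < C ∧ ∃ r : ℝ, 0 < r ∧ r < 1 ∧ ∀ z ∈ Λ, ∀ n : ℕ,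
      (∀ v, P z v = v → ‖fderiv ℂ (⇑(f ^ n)) z v‖ ≤ C * r ^ n * ‖v‖) ∧
      (∀ v, P z v = 0 → ‖fderiv ℂ (⇑((f ^ n)⁻¹)) z v‖ ≤ C * r ^ n * ‖v‖)

/-! ### Horseshoes and the horseshoe locus -/

/-- A topological conjugacy from `H_{a,c}` on `K^ℂ_{a,c}` to the full shift. -/
structure ShiftConjugacy (p : ℂ × ℂ) where
  /-- the underlying homeomorphism -/
  homeo : K p ≃ₜ Sigma2
  /-- it intertwines the Hénon map and the shift -/
  semiconj : Function.Semiconj homeo (henonK p) shift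

/-- `K^ℂ_{a,c}` is a hyperbolic full horseshoe (the conjugacy forces it to be compact). -/
def IsHyperbolicFullHorseshoe (p : ℂ × ℂ) : Prop :=
  (∃ hp : p.1 ≠ 0, IsUniformlyHyperbolicOn (henonPerm p hp) (K p)) ∧
    Nonempty (ShiftConjugacy p)

/-- The hyperbolic horseshoe locus `ℋ^ℂ ⊂ ℂ²`. -/
def horseshoeLocus : Set (ℂ × ℂ) := {p | IsHyperbolicFullHorseshoe p}

/-- The Hubbard–Oberste-Vorth region. -/
def HOV : Set (ℂ × ℂ) := {p | 2 * (‖p.1‖ + 1) ^ 2 < ‖p.2‖ ∧ p.1 ≠ 0}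

/-- The Devaney–Nitecki region. -/
def DN : Set (ℝ × ℝ) :=
  {q | q.2 < -((5 + 2 * Real.sqrt 5) * (|q.1| + 1) ^ 2 / 4) ∧ q.1 ≠ 0}

/-- `ℋ₀^ℂ`, the component of `ℋ^ℂ` that contains the region `HOV`: the set of the points that
lie in the same component of `ℋ^ℂ` as some point of `HOV`. (`HOV` is a connected subset of
`ℋ^ℂ`, so this is one component.) -/
def horseshoeLocus₀ : Set (ℂ × ℂ) :=
  {p | ∃ q ∈ HOV, p ∈ connectedComponentIn horseshoeLocus q}

/-! ### Continuation of conjugacies and monodromy -/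

/-- A continuous family of conjugacies `h_t : K^ℂ_{γ(t)} → Σ₂` along the path `γ`. Continuity in
`t` means that the inverse `h_t⁻¹ s ∈ ℂ²` depends continuously on `(t, s)`; in particular every
point `h_t⁻¹ s` moves continuously with `t`. -/
structure ConjugacyFamily {p q : ℂ × ℂ} (γ : Path p q) where
  /-- the conjugacy at time `t` -/
  conj : ∀ t : I, ShiftConjugacy (γ t)
  /-- continuity of the family -/
  continuous_symm :
    Continuous fun x : I × Sigma2 => (((conj x.1).homeo.symm x.2 : K (γ x.1)) : ℂ × ℂ)

/-- The family starts at the given conjugacy: `h_0⁻¹ = h0⁻¹` as maps `Σ₂ → ℂ²`, where `h0` is a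
conjugacy on `K^ℂ` at the initial point `p = γ(0)`. -/
def ConjugacyFamily.StartsAt {p q : ℂ × ℂ} {γ : Path p q} (h : ConjugacyFamily γ)
    (h0 : ShiftConjugacy p) : Prop :=
  ∀ s : Sigma2, (((h.conj 0).homeo.symm s : K (γ 0)) : ℂ × ℂ) = (h0.homeo.symm s : K p)

/-- The monodromy `ρ(γ) = h_1 ∘ h_0⁻¹ : Σ₂ → Σ₂` of a loop `γ`, computed from the continuous
family `h` of conjugacies along `γ`. -/
noncomputable def ConjugacyFamily.monodromy {p : ℂ × ℂ} {γ : Path p p} (h : ConjugacyFamily γ) :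
    Sigma2 ≃ₜ Sigma2 :=
  ((h.conj 0).homeo.symm.trans
    (Homeomorph.setCongr (by rw [γ.source, γ.target] : K (γ 0) = K (γ 1)))).trans
      (h.conj 1).homeo

theorem setCongr_henonK {p q : ℂ × ℂ} (e : p = q) (e' : K p = K q) (z : K p) :
    Homeomorph.setCongr e' (henonK p z) = henonK q (Homeomorph.setCongr e' z) := by
  subst e
  rfl

theorem ConjugacyFamily.monodromy_shift {p : ℂ × ℂ} {γ : Path p p} (h : ConjugacyFamily γ)
    (s : Sigma2) : h.monodromy (shift s) = shift (h.monodromy s) := by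
  have h0 : (h.conj 0).homeo.symm (shift s) = henonK (γ 0) ((h.conj 0).homeo.symm s) := by
    rw [Homeomorph.symm_apply_eq, (h.conj 0).semiconj, Homeomorph.apply_symm_apply]
  simp only [ConjugacyFamily.monodromy, Homeomorph.trans_apply]
  rw [h0, setCongr_henonK (by rw [γ.source, γ.target]), (h.conj 1).semiconj]

theorem ConjugacyFamily.shift_mem_fix {p : ℂ × ℂ} {γ : Path p p} (h : ConjugacyFamily γ) :
    MapsTo shift (Function.fixedPoints h.monodromy) (Function.fixedPoints h.monodromy) := by
  intro s hs
  change h.monodromy (shift s) = shift s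
  rw [h.monodromy_shift, hs]

/-- The restriction of the shift to `Fix (ρ(γ))`. -/
noncomputable def ConjugacyFamily.shiftFix {p : ℂ × ℂ} {γ : Path p p} (h : ConjugacyFamily γ) :
    Function.fixedPoints h.monodromy → Function.fixedPoints h.monodromy :=
  h.shift_mem_fix.restrict

/-! ### The symmetric loop -/

/-- Complex conjugation `(x, y) ↦ (x̄, ȳ)` on `ℂ²`. -/
noncomputable def conjC2 (z : ℂ × ℂ) : ℂ × ℂ := (starRingEnd ℂ z.1, starRingEnd ℂ z.2)

theorem continuous_conjC2 : Continuous conjC2 :=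
  (Complex.continuous_conj.comp continuous_fst).prodMk
    (Complex.continuous_conj.comp continuous_snd)

theorem conjC2_toComplex (q : ℝ × ℝ) : conjC2 (toComplex q) = toComplex q := by
  simp [conjC2, toComplex]

/-- The loop `ᾱ⁻¹ · α` for a path `α` between two real parameters: first `α` (for `t ≤ 1/2`),
then the complex conjugate of `α` run backwards. -/
noncomputable def symmetricLoop {q p : ℝ × ℝ} (α : Path (toComplex q) (toComplex p)) :
    Path (toComplex q) (toComplex q) :=
  α.trans ((α.map continuous_conjC2).symm.cast
    (conjC2_toComplex p).symm (conjC2_toComplex q).symm)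

/-- The time `1/2` in the unit interval. -/
noncomputable def half : I := ⟨1 / 2, by norm_num, by norm_num⟩

theorem symmetricLoop_half {q p : ℝ × ℝ} (α : Path (toComplex q) (toComplex p)) :
    symmetricLoop α half = toComplex p := by
  simp [symmetricLoop, half, Path.trans_apply]

/-- The inclusion of `K^ℝ_{a,c}` into `K^ℂ_{γ(1/2)}` when `γ(1/2) = (a, c)`. -/
def inclHalf {q p : ℝ × ℝ} {γ : Path (toComplex q) (toComplex q)}
    (hγ : γ half = toComplex p) (z : realK p) : K (γ half) :=
  ⟨toComplex z, by rw [hγ]; exact z.2⟩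

end HenonMonodromy

open HenonMonodromy

open Set unitInterval

/-! The theorem is a reflection argument. Write `φ (t, s)` for the point of `K (γ t)` with code `s`.
A symmetric loop satisfies `γ (1 - t) = conj (γ t)` (`symmetricLoop_symm`), so the conjugates of `φ
(1 - t, s)` form a second continuous family of coded points over the same loop. Over the
Devaney–Nitecki base point all bounded orbits are real (`im_eq_zero_of_mem_DN`), so at time `0` the
second family takes the value `φ (1, s)`. Hence `s` is fixed by the monodromy exactly when the two
families agree at `(0, s)`. Points of two families that coincide at one time coincide at all times
(`IsShiftFamily.eq_of_eq`), so this is agreement at time `1/2`, which says that `φ (1/2, s)` is real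
(`ConjugacyFamily.fixed_iff_real`).

Most of the work is structural stability, which supplies the families. Uniform hyperbolicity is
recast as invertibility of `v ↦ (v (n + 1) - A n (v n))ₙ` on bounded sequences (`IsDichotomy`). The
two forms are equivalent on a compact `K` (`OrbitHyperbolic.isUniformlyHyperbolicOn`,
`IsUniformlyHyperbolicOn.exists_orbitHyperbolic`). In the second form expansivity and persistence of
orbits are contraction arguments with explicit constants, and they give continuation
(`IsShiftFamily.exists_extension`, `IsShiftFamily.exists_continuation`).

The locus is open because bounded orbits of nearby maps are shadowed through the symbolic coding
(`ShiftConjugacy.eventually_shadowed`); hence its components are path connected. Independence of the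
chosen point of `HOV` needs no coding there: `HOV` is connected, and locally uniform hyperbolicity
on it makes the locus relatively closed, so one horseshoe in `HOV` forces all of `HOV` into the
locus (`HOV_subset_horseshoeLocus`). -/

namespace HenonMonodromy

/-! ### Nonautonomous linear equations on bounded sequences -/

section Linear

/-- A bounded family all of whose uniform bounds can be improved by a factor `k < 1` is zero. -/
theorem eq_zero_of_contracting {ι E : Type*} [NormedAddCommGroup E] {v : ι → E} {k : ℝ} (hk0 : 0 ≤ k)
    (hk : k < 1) (hb : ∃ B, ∀ n, ‖v n‖ ≤ B)
    (h : ∀ B, (∀ n, ‖v n‖ ≤ B) → ∀ n, ‖v n‖ ≤ k * B) (n : ι) : v n = 0 := by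
  obtain ⟨B, hB⟩ := hb
  have key : ∀ j : ℕ, ∀ n, ‖v n‖ ≤ k ^ j * B := by
    intro j
    induction j with
    | zero => simpa using hB
    | succ j ih => intro n; have := h _ ih n; rwa [pow_succ', mul_assoc]
  have lim : Filter.Tendsto (fun j : ℕ => k ^ j * B) Filter.atTop (nhds (0 * B)) :=
    (tendsto_pow_atTop_nhds_zero_of_lt_one hk0 hk).mul_const B
  rw [zero_mul] at lim
  exact norm_le_zero_iff.1 (ge_of_tendsto' lim fun j => key j n)

/-- Contraction principle in the sup norm on a ball of sequences. -/
theorem exists_fixed_sequence {ι E : Type*} [NormedAddCommGroup E] [CompleteSpace E]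
    (T : (ι → E) → ι → E) {ε k : ℝ} (hε : 0 ≤ ε) (hk0 : 0 ≤ k) (hk : k < 1)
    (hmap : ∀ u : ι → E, (∀ n, ‖u n‖ ≤ ε) → ∀ n, ‖T u n‖ ≤ ε)
    (hcon : ∀ u u' : ι → E, (∀ n, ‖u n‖ ≤ ε) → (∀ n, ‖u' n‖ ≤ ε) → ∀ B,
      (∀ n, ‖u n - u' n‖ ≤ B) → ∀ n, ‖T u n - T u' n‖ ≤ k * B) :
    ∃ u : ι → E, (∀ n, ‖u n‖ ≤ ε) ∧ T u = u := by
  let u : ℕ → ι → E := fun j => T^[j] 0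
  have us : ∀ j, u (j + 1) = T (u j) := fun j => Function.iterate_succ_apply' T j 0
  have hu : ∀ j n, ‖u j n‖ ≤ ε := by
    intro j
    induction j with
    | zero => intro n; simpa [u] using hε
    | succ j ih => rw [us]; exact hmap _ ih
  have hd : ∀ j n, ‖u j n - u (j + 1) n‖ ≤ 2 * ε * k ^ j := by
    intro j
    induction j with
    | zero =>
      intro n
      have := norm_sub_le (u 0 n) (u 1 n)
      have := hu 0 n
      have := hu 1 n
      simp only [pow_zero, mul_one, zero_add]
      linarith
    | succ j ih =>
      intro n
      have := hcon _ _ (hu j) (hu (j + 1)) _ ih n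
      rw [us, us (j + 1)]
      calc _ ≤ _ := this
        _ = _ := by ring
  have hd' : ∀ n j, dist (u j n) (u (j + 1) n) ≤ 2 * ε * k ^ j := by
    intro n j; rw [dist_eq_norm]; exact hd j n
  choose l hl using fun n => cauchySeq_tendsto_of_complete
    (cauchySeq_of_le_geometric k (2 * ε) hk (hd' n))
  have hlε : ∀ n, ‖l n‖ ≤ ε := fun n => le_of_tendsto' (hl n).norm fun j => hu j n
  -- The bound is uniform in `n`. This is what `hcon` needs, since `T` is not assumed continuous for
  -- pointwise convergence.
  have hdist : ∀ j n, ‖u j n - l n‖ ≤ 2 * ε * k ^ j / (1 - k) := by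
    intro j n
    rw [← dist_eq_norm]
    exact dist_le_of_le_geometric_of_tendsto k (2 * ε) hk (hd' n) (hl n) j
  refine ⟨l, hlε, funext fun n => ?_⟩
  have h1 : ∀ j, ‖u (j + 1) n - T l n‖ ≤ k * (2 * ε * k ^ j / (1 - k)) := by
    intro j; rw [us]; exact hcon _ _ (hu j) hlε _ (hdist j) n
  have h2 : Filter.Tendsto (fun j : ℕ => k * (2 * ε * k ^ j / (1 - k))) Filter.atTop (nhds 0) := by
    have := ((((tendsto_pow_atTop_nhds_zero_of_lt_one hk0 hk).const_mul (2 * ε)).div_const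
      (1 - k)).const_mul k)
    simpa using this
  have h3 : Filter.Tendsto (fun j => u (j + 1) n) Filter.atTop (nhds (T l n)) :=
    tendsto_iff_norm_sub_tendsto_zero.2 (squeeze_zero (fun _ => norm_nonneg _) h1 h2)
  exact tendsto_nhds_unique h3 ((Filter.tendsto_add_atTop_iff_nat 1).2 (hl n))

variable {E : Type*} [NormedAddCommGroup E] [NormedSpace ℂ E]

/-- The operator `v ↦ (v (n + 1) - A n (v n))ₙ` is invertible on bounded sequences, and the
inverse has norm at most `M`. -/
structure IsDichotomy (A : ℤ → E →L[ℂ] E) (M : ℝ) : Prop where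
  exists_solution : ∀ (f : ℤ → E) (B : ℝ), (∀ n, ‖f n‖ ≤ B) →
    ∃ v : ℤ → E, (∀ n, v (n + 1) = A n (v n) + f n) ∧ ∀ n, ‖v n‖ ≤ M * B
  unique : ∀ v : ℤ → E, (∃ B, ∀ n, ‖v n‖ ≤ B) → (∀ n, v (n + 1) = A n (v n)) → ∀ n, v n = 0

namespace IsDichotomy

variable {A : ℤ → E →L[ℂ] E} {M : ℝ}

theorem mono (h : IsDichotomy A M) {M' : ℝ} (hM : M ≤ M') : IsDichotomy A M' where
  exists_solution f B hf := by
    obtain ⟨v, hv, hb⟩ := h.exists_solution f B hf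
    exact ⟨v, hv, fun n => (hb n).trans
      (mul_le_mul_of_nonneg_right hM ((norm_nonneg _).trans (hf 0)))⟩
  unique := h.unique

theorem eq_of_solutions (h : IsDichotomy A M) {f v w : ℤ → E} (hv : ∃ B, ∀ n, ‖v n‖ ≤ B)
    (hw : ∃ B, ∀ n, ‖w n‖ ≤ B) (hv' : ∀ n, v (n + 1) = A n (v n) + f n)
    (hw' : ∀ n, w (n + 1) = A n (w n) + f n) (n : ℤ) : v n = w n := by
  obtain ⟨B, hB⟩ := hv
  obtain ⟨B', hB'⟩ := hw
  refine sub_eq_zero.1 (h.unique (fun n => v n - w n) ⟨B + B', fun n => ?_⟩ (fun n => ?_) n)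
  · exact (norm_sub_le _ _).trans (add_le_add (hB n) (hB' n))
  · simp only [hv', hw', map_sub]; abel

theorem norm_le (h : IsDichotomy A M) {f v : ℤ → E} {B : ℝ} (hf : ∀ n, ‖f n‖ ≤ B)
    (hv : ∃ B, ∀ n, ‖v n‖ ≤ B) (hv' : ∀ n, v (n + 1) = A n (v n) + f n) (n : ℤ) :
    ‖v n‖ ≤ M * B := by
  obtain ⟨w, hw, hb⟩ := h.exists_solution f B hf
  rw [h.eq_of_solutions hv ⟨_, hb⟩ hv' hw n]
  exact hb n

theorem shift (h : IsDichotomy A M) (k : ℤ) : IsDichotomy (fun n => A (n + k)) M where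
  exists_solution f B hf := by
    obtain ⟨v, hv, hb⟩ := h.exists_solution (fun n => f (n - k)) B fun n => hf _
    refine ⟨fun n => v (n + k), fun n => ?_, fun n => hb _⟩
    have := hv (n + k)
    rw [add_sub_cancel_right] at this
    rw [← this, add_right_comm]
  unique v hv hv' n := by
    obtain ⟨B, hB⟩ := hv
    have := h.unique (fun n => v (n - k)) ⟨B, fun n => hB _⟩ (fun n => ?_) (n + k)
    · simpa using this
    · have := hv' (n - k)
      rw [sub_add_cancel] at this
      rw [← this]; congr 1; ring

variable [CompleteSpace E]

/-- Bounded solutions of a nonlinear perturbation. -/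
theorem exists_solution_nonlinear (h : IsDichotomy A M) (hM : 0 ≤ M) (g : ℤ → E → E) {b k ε : ℝ}
    (hb : ∀ n, ‖g n 0‖ ≤ b) (hk0 : 0 ≤ k) (hk : M * k ≤ 1 / 2) (hε : 2 * M * b ≤ ε)
    (hg : ∀ n u u', ‖u‖ ≤ ε → ‖u'‖ ≤ ε → ‖g n u - g n u'‖ ≤ k * ‖u - u'‖) :
    ∃ v : ℤ → E, (∀ n, v (n + 1) = A n (v n) + g n (v n)) ∧ ∀ n, ‖v n‖ ≤ 2 * M * b := by
  have hb0 : 0 ≤ b := (norm_nonneg _).trans (hb 0)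
  have hε0 : 0 ≤ 2 * M * b := by positivity
  have hball : ∀ u : ℤ → E, (∀ n, ‖u n‖ ≤ 2 * M * b) →
      ∀ n, ‖g n (u n)‖ ≤ k * (2 * M * b) + b := by
    intro u hu n
    have h1 := hg n (u n) 0 ((hu n).trans hε) (by simpa using hε0.trans hε)
    rw [sub_zero] at h1
    have h2 : ‖g n (u n)‖ ≤ ‖g n (u n) - g n 0‖ + ‖g n 0‖ := norm_le_norm_sub_add _ _
    have h3 := mul_le_mul_of_nonneg_left (hu n) hk0
    linarith [hb n]
  -- `T u` will be the bounded solution of the linear equation with forcing `g n (u n)`. Outside the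
  -- ball its value is irrelevant and is taken to be `0`.
  have hex : ∀ u : ℤ → E, ∃ v : ℤ → E, (∀ n, ‖u n‖ ≤ 2 * M * b) →
      (∀ n, v (n + 1) = A n (v n) + g n (u n)) ∧ ∀ n, ‖v n‖ ≤ 2 * M * b := by
    intro u
    by_cases hu : ∀ n, ‖u n‖ ≤ 2 * M * b
    · obtain ⟨v, hv, hv'⟩ := h.exists_solution (fun n => g n (u n)) _ (hball u hu)
      refine ⟨v, fun _ => ⟨hv, fun n => (hv' n).trans ?_⟩⟩
      have : M * k * (2 * M * b) ≤ 1 / 2 * (2 * M * b) := mul_le_mul_of_nonneg_right hk hε0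
      linarith
    · exact ⟨0, fun h => absurd h hu⟩
  choose T hT using hex
  obtain ⟨u, hu, hTu⟩ := exists_fixed_sequence T hε0 (by norm_num : (0 : ℝ) ≤ 1 / 2) (by norm_num)
    (fun u hu => (hT u hu).2) (fun u u' hu hu' B hB n => by
      have h1 := h.norm_le (f := fun n => g n (u n) - g n (u' n))
        (v := fun n => T u n - T u' n) (B := k * B) (fun n =>
          (hg n _ _ ((hu n).trans hε) ((hu' n).trans hε)).trans
            (mul_le_mul_of_nonneg_left (hB n) hk0))
        ⟨_, fun n => (norm_sub_le _ _).trans (add_le_add ((hT u hu).2 n) ((hT u' hu').2 n))⟩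
        (fun n => by rw [(hT u hu).1, (hT u' hu').1, map_sub]; abel) n
      refine h1.trans ?_
      rw [← mul_assoc]
      exact mul_le_mul_of_nonneg_right hk ((norm_nonneg _).trans (hB 0)))
  refine ⟨u, fun n => ?_, hu⟩
  have := (hT u hu).1 n
  rwa [hTu] at this

/-- The term `(A' n - A n) (v n)` is treated as a forcing. As `M * k ≤ 1 / 2`, the resulting map
contracts by `1 / 2`, which at most doubles the norm of the inverse. -/
theorem perturb (h : IsDichotomy A M) (hM : 0 ≤ M) {A' : ℤ → E →L[ℂ] E} {k : ℝ}
    (hA : ∀ n, ‖A' n - A n‖ ≤ k) (hk : M * k ≤ 1 / 2) : IsDichotomy A' (2 * M) where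
  exists_solution f B hf := by
    have hk0 : 0 ≤ k := (norm_nonneg _).trans (hA 0)
    obtain ⟨v, hv, hb⟩ := h.exists_solution_nonlinear hM (fun n u => (A' n - A n) u + f n) (b := B)
      (by simpa using hf) hk0 hk le_rfl (fun n u u' _ _ => by
        rw [add_sub_add_right_eq_sub, ← map_sub]
        exact (ContinuousLinearMap.le_opNorm _ _).trans
          (mul_le_mul_of_nonneg_right (hA n) (norm_nonneg _)))
    refine ⟨v, fun n => ?_, hb⟩
    rw [hv, sub_apply]
    abel
  unique v hv hv' := by
    have hk0 : 0 ≤ k := (norm_nonneg _).trans (hA 0)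
    refine eq_zero_of_contracting (k := 1 / 2) (by norm_num) (by norm_num) hv fun B hB n => ?_
    have h1 := h.norm_le (f := fun n => (A' n - A n) (v n)) (v := v) (B := k * B) (fun n =>
      (ContinuousLinearMap.le_opNorm _ _).trans
        (mul_le_mul (hA n) (hB n) (norm_nonneg _) hk0)) hv
      (fun n => by rw [hv', sub_apply]; abel) n
    refine h1.trans ?_
    rw [← mul_assoc]
    exact mul_le_mul_of_nonneg_right hk ((norm_nonneg _).trans (hB 0))

/-- The bounded response to a forcing at time `-1` decays exponentially. -/
theorem exists_decaying_solution (h : IsDichotomy A M) (hM : 0 < M) {S q : ℝ} (hA : ∀ n, ‖A n‖ ≤ S)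
    (hq : 1 ≤ q) (hqS : M * ((q - 1) * S) ≤ 1 / 2) (e : E) :
    ∃ v : ℤ → E, (∀ n, v (n + 1) = A n (v n) + if n = -1 then e else 0) ∧
      ∀ n, ‖v n‖ ≤ 2 * M * ‖e‖ * q⁻¹ ^ n.natAbs := by
  have hq0 : 0 < q := by linarith
  have hS : 0 ≤ S := (norm_nonneg _).trans (hA 0)
  have hratio : ∀ n : ℤ, |q ^ (n + 1).natAbs / q ^ n.natAbs - 1| ≤ q - 1 := by
    intro n
    rcases le_or_gt 0 n with hn | hn
    · have : (n + 1).natAbs = n.natAbs + 1 := by omega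
      rw [this, pow_succ, mul_div_cancel_left₀ _ (by positivity), abs_of_nonneg (by linarith)]
    · have : n.natAbs = (n + 1).natAbs + 1 := by omega
      rw [this, pow_succ, div_mul_cancel_left₀ (by positivity)]
      have h1 : q⁻¹ ≤ 1 := inv_le_one_of_one_le₀ hq
      have h2 : q * q⁻¹ = 1 := mul_inv_cancel₀ hq0.ne'
      rw [abs_of_nonpos (by linarith)]
      nlinarith [sq_nonneg (q - 1), inv_pos.2 hq0]
  -- Rescaling a solution by the weights `q ^ |n|` multiplies `A n` by a ratio within `q - 1` of
  -- `1`. Bounded solutions of the rescaled equation decay after the weights are removed. A forcing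
  -- at time `-1` acts on index `0`, where the weight is `1`, and so is unchanged.
  have hp := h.perturb hM.le
    (A' := fun n => ((q ^ (n + 1).natAbs / q ^ n.natAbs : ℝ) : ℂ) • A n) (k := (q - 1) * S)
    (fun n => by
      have : ((q ^ (n + 1).natAbs / q ^ n.natAbs : ℝ) : ℂ) • A n - A n
          = ((q ^ (n + 1).natAbs / q ^ n.natAbs - 1 : ℝ) : ℂ) • A n := by
        push_cast; rw [sub_smul, one_smul]
      rw [this, norm_smul, Complex.norm_real, Real.norm_eq_abs]
      exact mul_le_mul (hratio n) (hA n) (norm_nonneg _) (by linarith)) hqS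
  obtain ⟨v, hv, hb⟩ := hp.exists_solution (fun n => if n = -1 then e else 0) ‖e‖
    (fun n => by split_ifs <;> simp)
  refine ⟨fun n => ((q⁻¹ ^ n.natAbs : ℝ) : ℂ) • v n, fun n => ?_, fun n => ?_⟩
  · simp only [hv n, smul_add, smul_apply, map_smul, smul_smul,
      ← Complex.ofReal_mul]
    congr 2
    · congr 2
      rw [inv_pow, inv_pow]
      field_simp
    · split_ifs with hn
      · subst hn; simp
      · simp
  · rw [norm_smul, Complex.norm_real, Real.norm_eq_abs, abs_of_nonneg (by positivity), mul_comm]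
    exact mul_le_mul_of_nonneg_right (hb n) (by positivity)

end IsDichotomy

end Linear

/-! ### Bounded orbits -/

/-- The bounded bi-infinite orbits of the Hénon map. -/
def boundedOrbits (p : ℂ × ℂ) : Set (ℤ → ℂ × ℂ) :=
  {z | (∀ n, z (n + 1) = henon p (z n)) ∧ ∃ B, ∀ n, ‖z n‖ ≤ B}

theorem orbit_eq_zpow {p : ℂ × ℂ} (hp : p.1 ≠ 0) {z : ℤ → ℂ × ℂ}
    (hz : ∀ n, z (n + 1) = henon p (z n)) (k n : ℤ) : z (k + n) = (henonPerm p hp ^ n) (z k) := by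
  have hz' : ∀ n, z (n + 1) = henonPerm p hp (z n) := hz
  induction n with
  | zero => simp
  | succ i ih =>
    rw [← add_assoc, hz', ih, add_comm (i : ℤ) 1, zpow_one_add, Equiv.Perm.mul_apply]
  | pred i ih =>
    have h1 := hz' (k + (-(i : ℤ) - 1))
    rw [show k + (-(i : ℤ) - 1) + 1 = k + -(i : ℤ) by ring, ih] at h1
    apply (henonPerm p hp).injective
    rw [← h1, ← Equiv.Perm.mul_apply, ← zpow_one_add]
    congr 2; ring

theorem orbit_ext {p : ℂ × ℂ} (hp : p.1 ≠ 0) {z w : ℤ → ℂ × ℂ}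
    (hz : ∀ n, z (n + 1) = henon p (z n)) (hw : ∀ n, w (n + 1) = henon p (w n)) (k : ℤ)
    (h : z k = w k) : z = w := by
  funext n
  have h1 := orbit_eq_zpow hp hz k (n - k)
  have h2 := orbit_eq_zpow hp hw k (n - k)
  rw [add_sub_cancel] at h1 h2
  rw [h1, h2, h]

theorem shift_mem_boundedOrbits {p : ℂ × ℂ} {z : ℤ → ℂ × ℂ} (hz : z ∈ boundedOrbits p) (k : ℤ) :
    (fun n => z (n + k)) ∈ boundedOrbits p := by
  obtain ⟨h, B, hB⟩ := hz
  refine ⟨fun n => ?_, B, fun n => hB _⟩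
  simp only [← h]
  congr 1; ring

theorem mem_K_iff {p : ℂ × ℂ} {w : ℂ × ℂ} :
    w ∈ K p ↔ p.1 ≠ 0 ∧ ∃ z ∈ boundedOrbits p, z 0 = w := by
  constructor
  · rintro ⟨hp, hb⟩
    obtain ⟨B, hB⟩ := hb.exists_norm_le
    refine ⟨hp, fun n => (henonPerm p hp ^ n) w, ⟨fun n => ?_, B, fun n => hB _ ⟨n, rfl⟩⟩, rfl⟩
    change _ = henonPerm p hp _
    rw [← Equiv.Perm.mul_apply, ← zpow_one_add, add_comm]
  · rintro ⟨hp, z, ⟨hz, B, hB⟩, rfl⟩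
    refine ⟨hp, isBounded_iff_forall_norm_le.2 ⟨B, ?_⟩⟩
    rintro _ ⟨n, rfl⟩
    have := orbit_eq_zpow hp hz 0 n
    simp only
    rw [← this]
    exact hB _

theorem apply_mem_K {p : ℂ × ℂ} (hp : p.1 ≠ 0) {z : ℤ → ℂ × ℂ} (hz : z ∈ boundedOrbits p) (n : ℤ) :
    z n ∈ K p :=
  mem_K_iff.2 ⟨hp, _, shift_mem_boundedOrbits hz n, by simp⟩

theorem orbit_snd {p : ℂ × ℂ} {z : ℤ → ℂ × ℂ} (hz : z ∈ boundedOrbits p) (n : ℤ) :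
    (z (n + 1)).2 = (z n).1 := by rw [hz.1]; rfl

theorem orbit_fst {p : ℂ × ℂ} {z : ℤ → ℂ × ℂ} (hz : z ∈ boundedOrbits p) (n : ℤ) :
    (z n).1 ^ 2 = (z (n + 1)).1 + p.1 * (z n).2 - p.2 := by rw [hz.1]; simp [henon]

/-- A priori bound for bounded orbits. -/
theorem norm_le_of_mem_boundedOrbits {p : ℂ × ℂ} {z : ℤ → ℂ × ℂ} (hz : z ∈ boundedOrbits p) {T : ℝ}
    (hT0 : 0 < T) (hT : (1 + ‖p.1‖) * T + ‖p.2‖ ≤ T ^ 2) (n : ℤ) : ‖z n‖ ≤ T := by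
  obtain ⟨B, hB⟩ := hz.2
  have hbdd : BddAbove (range fun n => ‖z n‖) := ⟨B, by rintro _ ⟨n, rfl⟩; exact hB n⟩
  set S := ⨆ n, ‖z n‖ with hS
  have hzS : ∀ n, ‖z n‖ ≤ S := fun n => le_ciSup hbdd n
  have hS0 : 0 ≤ S := (norm_nonneg _).trans (hzS 0)
  have hx : ∀ n, ‖(z n).1‖ ^ 2 ≤ (1 + ‖p.1‖) * S + ‖p.2‖ := by
    intro n
    rw [← norm_pow, orbit_fst hz]
    have h1 : ‖(z (n + 1)).1‖ ≤ S := (norm_fst_le _).trans (hzS _)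
    have h2 : ‖(z n).2‖ ≤ S := (norm_snd_le _).trans (hzS _)
    calc _ ≤ ‖(z (n + 1)).1‖ + ‖p.1 * (z n).2‖ + ‖p.2‖ :=
          (norm_sub_le _ _).trans (add_le_add_left (norm_add_le _ _) _)
      _ ≤ S + ‖p.1‖ * S + ‖p.2‖ := by rw [norm_mul]; gcongr
      _ = _ := by ring
  have hz2 : ∀ n, ‖z n‖ ≤ √((1 + ‖p.1‖) * S + ‖p.2‖) := by
    intro n
    refine max_le (Real.le_sqrt_of_sq_le (hx n)) (Real.le_sqrt_of_sq_le ?_)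
    have := hx (n - 1)
    rwa [← orbit_snd hz, sub_add_cancel] at this
  -- The supremum satisfies the reverse of the inequality `hT`, so it cannot exceed `T`: both are
  -- compared with the positive root of the same quadratic.
  have hS2 : S ^ 2 ≤ (1 + ‖p.1‖) * S + ‖p.2‖ := by
    have : S ≤ √((1 + ‖p.1‖) * S + ‖p.2‖) := ciSup_le hz2
    exact (Real.le_sqrt hS0 (by positivity)).1 this
  refine (hzS n).trans ?_
  by_contra! hlt
  have h3 : 0 ≤ T - (1 + ‖p.1‖) := by
    by_contra! h
    nlinarith [norm_nonneg p.2]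
  nlinarith

/-- The radius of a bidisk that contains all bounded orbits. -/
noncomputable def escapeRadius (p : ℂ × ℂ) : ℝ := 1 + ‖p.1‖ + ‖p.2‖

theorem one_le_escapeRadius (p : ℂ × ℂ) : 1 ≤ escapeRadius p := by
  unfold escapeRadius; linarith [norm_nonneg p.1, norm_nonneg p.2]

theorem continuous_escapeRadius : Continuous escapeRadius := by
  unfold escapeRadius; fun_prop

theorem norm_le_escapeRadius {p : ℂ × ℂ} {z : ℤ → ℂ × ℂ} (hz : z ∈ boundedOrbits p) (n : ℤ) :
    ‖z n‖ ≤ escapeRadius p := by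
  refine norm_le_of_mem_boundedOrbits hz (by linarith [one_le_escapeRadius p]) ?_ n
  unfold escapeRadius
  nlinarith [norm_nonneg p.1, norm_nonneg p.2, mul_nonneg (norm_nonneg p.1) (norm_nonneg p.2)]

theorem continuous_henon {X : Type*} [TopologicalSpace X] {f g : X → ℂ × ℂ} (hf : Continuous f)
    (hg : Continuous g) : Continuous fun x => henon (f x) (g x) := by
  unfold henon; fun_prop

/-! ### Uniform hyperbolicity along orbits -/

/-- The derivative of the Hénon map. -/
noncomputable def henonDeriv (p z : ℂ × ℂ) : ℂ × ℂ →L[ℂ] ℂ × ℂ :=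
  ((2 * z.1) • ContinuousLinearMap.fst ℂ ℂ ℂ - p.1 • ContinuousLinearMap.snd ℂ ℂ ℂ).prod
    (ContinuousLinearMap.fst ℂ ℂ ℂ)

theorem henonDeriv_apply (p z v : ℂ × ℂ) :
    henonDeriv p z v = (2 * z.1 * v.1 - p.1 * v.2, v.1) := rfl

/-- The map is quadratic, so its Taylor expansion is exact, and the remainder depends on neither `p`
nor `z`. -/
theorem henon_add (p z v : ℂ × ℂ) :
    henon p (z + v) = henon p z + henonDeriv p z v + (v.1 ^ 2, 0) := by
  simp only [henon, henonDeriv_apply]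
  ext <;> simp
  ring

theorem hasFDerivAt_henon (p z : ℂ × ℂ) : HasFDerivAt (henon p) (henonDeriv p z) z := by
  have h1 : HasFDerivAt (fun z : ℂ × ℂ => z.1) (ContinuousLinearMap.fst ℂ ℂ ℂ) z := hasFDerivAt_fst
  have h2 : HasFDerivAt (fun z : ℂ × ℂ => z.2) (ContinuousLinearMap.snd ℂ ℂ ℂ) z := hasFDerivAt_snd
  have h3 := (((h1.pow 2).add_const p.2).sub (h2.const_mul p.1)).prodMk h1
  have e : henonDeriv p z = ((2 • z.1 ^ (2 - 1)) • ContinuousLinearMap.fst ℂ ℂ ℂ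
      - p.1 • ContinuousLinearMap.snd ℂ ℂ ℂ).prod (ContinuousLinearMap.fst ℂ ℂ ℂ) := by
    simp [henonDeriv]
  rw [e]
  exact h3

theorem norm_henonDeriv_sub_le (p p' z z' : ℂ × ℂ) :
    ‖henonDeriv p' z' - henonDeriv p z‖ ≤ 2 * ‖z' - z‖ + ‖p' - p‖ := by
  refine ContinuousLinearMap.opNorm_le_bound _ (by positivity) fun v => ?_
  rw [sub_apply, henonDeriv_apply, henonDeriv_apply]
  have h : ((2 * z'.1 * v.1 - p'.1 * v.2, v.1) : ℂ × ℂ) - (2 * z.1 * v.1 - p.1 * v.2, v.1)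
      = (2 * (z' - z).1 * v.1 - (p' - p).1 * v.2, 0) := by
    ext <;> simp
    ring
  rw [h]
  refine max_le ?_ (by simp; positivity)
  calc ‖2 * (z' - z).1 * v.1 - (p' - p).1 * v.2‖
      ≤ ‖2 * (z' - z).1 * v.1‖ + ‖(p' - p).1 * v.2‖ := norm_sub_le _ _
    _ = 2 * ‖(z' - z).1‖ * ‖v.1‖ + ‖(p' - p).1‖ * ‖v.2‖ := by simp only [norm_mul]; norm_num
    _ ≤ 2 * ‖z' - z‖ * ‖v‖ + ‖p' - p‖ * ‖v‖ := by
        gcongr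
        exacts [norm_fst_le _, norm_fst_le _, norm_fst_le _, norm_snd_le _]
    _ = _ := by ring

theorem norm_henonDeriv_le (p z : ℂ × ℂ) : ‖henonDeriv p z‖ ≤ 1 + 2 * ‖z‖ + ‖p‖ := by
  refine ContinuousLinearMap.opNorm_le_bound _ (by positivity) fun v => ?_
  rw [henonDeriv_apply]
  have h1 := norm_fst_le v
  have h2 := norm_snd_le v
  have h3 := norm_fst_le z
  have h4 := norm_fst_le p
  refine max_le ?_ ?_
  · calc ‖2 * z.1 * v.1 - p.1 * v.2‖
        ≤ ‖2 * z.1 * v.1‖ + ‖p.1 * v.2‖ := norm_sub_le _ _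
      _ = 2 * ‖z.1‖ * ‖v.1‖ + ‖p.1‖ * ‖v.2‖ := by simp only [norm_mul]; norm_num
      _ ≤ 2 * ‖z‖ * ‖v‖ + ‖p‖ * ‖v‖ := by gcongr
      _ ≤ _ := by nlinarith [norm_nonneg v]
  · have : (0 : ℝ) ≤ (2 * ‖z‖ + ‖p‖) * ‖v‖ := by positivity
    simp only
    nlinarith

/-- The Hénon map is hyperbolic along all its bounded orbits, with constant `M`. -/
structure OrbitHyperbolic (p : ℂ × ℂ) (M : ℝ) : Prop where
  ne_zero : p.1 ≠ 0
  one_le : 1 ≤ M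
  dichotomy : ∀ z ∈ boundedOrbits p, IsDichotomy (fun n => henonDeriv p (z n)) M

theorem OrbitHyperbolic.mono {p : ℂ × ℂ} {M M' : ℝ} (h : OrbitHyperbolic p M) (hM : M ≤ M') :
    OrbitHyperbolic p M' :=
  ⟨h.ne_zero, h.one_le.trans hM, fun z hz => (h.dichotomy z hz).mono hM⟩

/-- Expansivity. -/
theorem OrbitHyperbolic.eq_of_close {p : ℂ × ℂ} {M : ℝ} (h : OrbitHyperbolic p M)
    {z w : ℤ → ℂ × ℂ} (hz : z ∈ boundedOrbits p) (hw : w ∈ boundedOrbits p)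
    (hzw : ∀ n, ‖w n - z n‖ ≤ 1 / (2 * M)) : z = w := by
  have hM := h.one_le
  have key : ∀ n, w n - z n = 0 := by
    refine eq_zero_of_contracting (k := 1 / 2) (by norm_num) (by norm_num) ⟨_, hzw⟩ fun B hB n => ?_
    -- The difference of the orbits solves the linearized equation with its own squared first
    -- coordinate as forcing, of size at most `B / (2 * M)`. Inverting costs a factor `M`, which
    -- leaves `B / 2`.
    have h1 := (h.dichotomy z hz).norm_le (f := fun n => ((w n - z n).1 ^ 2, 0))
      (v := fun n => w n - z n) (B := 1 / (2 * M) * B) (fun n => by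
        have hB0 : 0 ≤ B := (norm_nonneg _).trans (hB 0)
        have h3 := norm_fst_le (w n - z n)
        refine max_le ?_ (by simp; positivity)
        rw [norm_pow, sq]
        exact mul_le_mul (h3.trans (hzw n)) (h3.trans (hB n)) (norm_nonneg _) (by positivity))
      ⟨_, hzw⟩ (fun n => by
        have := henon_add p (z n) (w n - z n)
        rw [add_sub_cancel] at this
        rw [hz.1, hw.1, this]; abel) n
    refine h1.trans (le_of_eq ?_)
    field_simp
  exact funext fun n => (sub_eq_zero.1 (key n)).symm

/-- Every bounded orbit persists under a small change of the parameter. -/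
theorem OrbitHyperbolic.exists_close_orbit {p p' : ℂ × ℂ} {M r : ℝ} (h : OrbitHyperbolic p M)
    (hr : escapeRadius p ≤ r) (hp : ‖p' - p‖ ≤ 1 / (16 * M ^ 2 * (1 + r))) {z : ℤ → ℂ × ℂ}
    (hz : z ∈ boundedOrbits p) :
    ∃ w ∈ boundedOrbits p', ∀ n, ‖w n - z n‖ ≤ 1 / (8 * M) := by
  have hM := h.one_le
  have hr1 : 1 ≤ r := (one_le_escapeRadius p).trans hr
  have hzr : ∀ n, ‖z n‖ ≤ r := fun n => (norm_le_escapeRadius hz n).trans hr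
  set d := 1 / (16 * M ^ 2 * (1 + r)) with hd
  have hd0 : 0 ≤ d := by positivity
  -- The threshold `d` is chosen so that the radius `2 * M * b` of the nonlinear lemma, with `b = d
  -- * (1 + r)`, equals `1 / (8 * M)`.
  have hdM : 2 * M * (d * (1 + r)) = 1 / (8 * M) := by rw [hd]; field_simp; norm_num
  have hdM' : M * d ≤ 1 / 16 := by
    have : M * d = 1 / (16 * (M * (1 + r))) := by rw [hd]; field_simp
    rw [this]
    apply one_div_le_one_div_of_le (by norm_num)
    nlinarith
  have h1 : ‖(p' - p).1‖ ≤ d := (norm_fst_le _).trans hp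
  have h2 : ‖(p' - p).2‖ ≤ d := (norm_snd_le _).trans hp
  obtain ⟨v, hv, hb⟩ := (h.dichotomy z hz).exists_solution_nonlinear (by linarith)
    (fun n u => (u.1 ^ 2 + (p' - p).2 - (p' - p).1 * ((z n).2 + u.2), 0))
    (b := d * (1 + r)) (k := 2 * (1 / (8 * M)) + d) (ε := 1 / (8 * M))
    (fun n => by
      refine max_le ?_ (by simp; positivity)
      have : ‖(z n).2‖ ≤ r := (norm_snd_le _).trans (hzr n)
      calc ‖(0 : ℂ × ℂ).1 ^ 2 + (p' - p).2 - (p' - p).1 * ((z n).2 + (0 : ℂ × ℂ).2)‖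
          = ‖(p' - p).2 - (p' - p).1 * (z n).2‖ := by simp
        _ ≤ ‖(p' - p).2‖ + ‖(p' - p).1‖ * ‖(z n).2‖ := by rw [← norm_mul]; exact norm_sub_le _ _
        _ ≤ d + d * r := by gcongr
        _ = _ := by ring)
    (by positivity)
    (by
      have : M * (2 * (1 / (8 * M)) + d) = 1 / 4 + M * d := by field_simp; ring
      rw [this]; linarith)
    hdM.le
    (fun n u u' hu hu' => by
      have e : ((u.1 ^ 2 + (p' - p).2 - (p' - p).1 * ((z n).2 + u.2), 0) : ℂ × ℂ)
          - (u'.1 ^ 2 + (p' - p).2 - (p' - p).1 * ((z n).2 + u'.2), 0)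
          = ((u.1 + u'.1) * (u - u').1 - (p' - p).1 * (u - u').2, 0) := by
        ext <;> simp
        ring
      rw [e]
      refine max_le ?_ (by simp; positivity)
      have a1 := (norm_fst_le u).trans hu
      have a2 := (norm_fst_le u').trans hu'
      calc ‖(u.1 + u'.1) * (u - u').1 - (p' - p).1 * (u - u').2‖
          ≤ ‖u.1 + u'.1‖ * ‖(u - u').1‖ + ‖(p' - p).1‖ * ‖(u - u').2‖ := by
            rw [← norm_mul, ← norm_mul]; exact norm_sub_le _ _
        _ ≤ (1 / (8 * M) + 1 / (8 * M)) * ‖u - u'‖ + d * ‖u - u'‖ := by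
            gcongr
            exacts [(norm_add_le _ _).trans (add_le_add a1 a2), norm_fst_le _, norm_snd_le _]
        _ = _ := by ring)
  rw [hdM] at hb
  refine ⟨fun n => z n + v n, ⟨fun n => ?_, r + 1 / (8 * M), fun n => ?_⟩, fun n => by simpa using hb n⟩
  · change z (n + 1) + v (n + 1) = henon p' (z n + v n)
    rw [hv, hz.1]
    simp only [henonDeriv_apply, henon]
    ext <;> simp
    ring
  · exact (norm_add_le _ _).trans (add_le_add (hzr n) (hb n))

/-- Hyperbolicity passes to orbits that are shadowed. -/
theorem OrbitHyperbolic.of_shadowing {p p' : ℂ × ℂ} {M : ℝ} (h : OrbitHyperbolic p M)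
    (hp' : p'.1 ≠ 0) (hp : ‖p' - p‖ ≤ 1 / (8 * M))
    (hs : ∀ w ∈ boundedOrbits p', ∃ z ∈ boundedOrbits p, ∀ n, ‖w n - z n‖ ≤ 1 / (8 * M)) :
    OrbitHyperbolic p' (2 * M) := by
  have hM := h.one_le
  refine ⟨hp', by linarith, fun w hw => ?_⟩
  obtain ⟨z, hz, hwz⟩ := hs w hw
  refine (h.dichotomy z hz).perturb (by linarith) (k := 3 * (1 / (8 * M))) (fun n => ?_) ?_
  · have := norm_henonDeriv_sub_le p p' (z n) (w n)
    linarith [hwz n]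
  · have : M * (3 * (1 / (8 * M))) = 3 / 8 := by field_simp
    rw [this]; norm_num

/-! ### From dichotomies to invariant splittings -/

section Projection

theorem bounded_of_decay {E : Type*} [NormedAddCommGroup E] {r : ℝ} {v : ℤ → E} {c : ℝ} (hr0 : 0 ≤ r) (hr1 : r ≤ 1)
    (h : ∀ n, ‖v n‖ ≤ c * r ^ n.natAbs) : ∃ B, ∀ n, ‖v n‖ ≤ B := by
  have hc : 0 ≤ c := by simpa using (norm_nonneg _).trans (h 0)
  exact ⟨c, fun n => (h n).trans (mul_le_of_le_one_right hc (pow_le_one₀ hr0 hr1))⟩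

variable {E : Type*} [NormedAddCommGroup E] [NormedSpace ℂ E]

/-- `P e` is the value at time `0` of the decaying response to the forcing `e` at time `-1`. -/
def IsStableProjection (A : ℤ → E →L[ℂ] E) (C r : ℝ) (P : E →L[ℂ] E) : Prop :=
  ∀ e, ∃ v : ℤ → E, (∀ n, v (n + 1) = A n (v n) + if n = -1 then e else 0) ∧
    (∀ n, ‖v n‖ ≤ C * ‖e‖ * r ^ n.natAbs) ∧ v 0 = P e

variable {A : ℤ → E →L[ℂ] E} {M C r : ℝ} {P : E →L[ℂ] E}

/-- Linearity of the response in `e` follows from uniqueness of bounded solutions. -/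
theorem IsDichotomy.exists_isStableProjection [CompleteSpace E] (h : IsDichotomy A M) (hM : 0 < M)
    {S q : ℝ} (hA : ∀ n, ‖A n‖ ≤ S) (hq : 1 ≤ q) (hqS : M * ((q - 1) * S) ≤ 1 / 2) :
    ∃ P, IsStableProjection A (2 * M) q⁻¹ P := by
  choose v hv hb using h.exists_decaying_solution hM hA hq hqS
  have hq0 : 0 ≤ q⁻¹ := by positivity
  have hbd : ∀ e, ∃ B, ∀ n, ‖v e n‖ ≤ B := fun e =>
    bounded_of_decay hq0 (inv_le_one_of_one_le₀ hq) (hb e)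
  let L : E →ₗ[ℂ] E :=
    { toFun := fun e => v e 0
      map_add' := fun e e' => by
        obtain ⟨B, hB⟩ := hbd e
        obtain ⟨B', hB'⟩ := hbd e'
        refine h.eq_of_solutions (w := fun n => v e n + v e' n) (hbd _)
          ⟨B + B', fun n => (norm_add_le _ _).trans (add_le_add (hB n) (hB' n))⟩ (hv _) (fun n => ?_) 0
        simp only [hv, map_add]
        split_ifs <;> abel
      map_smul' := fun c e => by
        obtain ⟨B, hB⟩ := hbd e
        refine h.eq_of_solutions (w := fun n => c • v e n) (hbd _)
          ⟨‖c‖ * B, fun n => by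
            rw [norm_smul]; exact mul_le_mul_of_nonneg_left (hB n) (norm_nonneg _)⟩
          (hv _) (fun n => ?_) 0
        simp only [hv, map_smul, smul_add]
        split_ifs <;> simp }
  exact ⟨L.mkContinuous (2 * M) fun e => (hb e 0).trans (by simp), fun e => ⟨v e, hv e, hb e, rfl⟩⟩

namespace IsStableProjection

/-- Extended by `0` to negative times, `u` is itself the bounded response to the forcing `u 0` at
time `-1`. So the vectors with bounded forward solutions are fixed by `P`. -/
theorem apply_of_forward (hP : IsStableProjection A C r P) (h : IsDichotomy A M) (hr0 : 0 ≤ r)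
    (hr1 : r ≤ 1) {u : ℤ → E} (hu : ∀ n, 0 ≤ n → u (n + 1) = A n (u n))
    (hb : ∃ B, ∀ n, 0 ≤ n → ‖u n‖ ≤ B) :
    P (u 0) = u 0 ∧ ∀ n, 0 ≤ n → ‖u n‖ ≤ C * ‖u 0‖ * r ^ n.natAbs := by
  obtain ⟨v, hv, hvb, hv0⟩ := hP (u 0)
  obtain ⟨B, hB⟩ := hb
  have hB0 : 0 ≤ B := (norm_nonneg _).trans (hB 0 le_rfl)
  have key := h.eq_of_solutions (w := fun n => if 0 ≤ n then u n else 0)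
    (bounded_of_decay hr0 hr1 hvb)
    ⟨B, fun n => by split_ifs with hn; exacts [hB n hn, by simpa using hB0]⟩ hv (fun n => by
      rcases lt_trichotomy n (-1) with hn | rfl | hn
      · rw [if_neg (by omega), if_neg (by omega), if_neg (by omega)]; simp
      · simp
      · rw [if_pos (by omega), if_pos (by omega), if_neg (by omega), hu n (by omega), add_zero])
  refine ⟨?_, fun n hn => ?_⟩
  · rw [← hv0, key 0]; simp
  · have := hvb n
    rwa [key n, if_pos hn] at this

/-- The response to the forcing `u 0` is `-u` at negative times and `0` afterwards: at time `-1` the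
forcing cancels the image of `-u (-1)`. -/
theorem apply_of_backward (hP : IsStableProjection A C r P) (h : IsDichotomy A M) (hr0 : 0 ≤ r)
    (hr1 : r ≤ 1) {u : ℤ → E} (hu : ∀ n, n < 0 → u (n + 1) = A n (u n))
    (hb : ∃ B, ∀ n, n ≤ 0 → ‖u n‖ ≤ B) : P (u 0) = 0 := by
  obtain ⟨v, hv, hvb, hv0⟩ := hP (u 0)
  obtain ⟨B, hB⟩ := hb
  have hB0 : 0 ≤ B := (norm_nonneg _).trans (hB 0 le_rfl)
  have key := h.eq_of_solutions (w := fun n => if n < 0 then -u n else 0)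
    (bounded_of_decay hr0 hr1 hvb)
    ⟨B, fun n => by
      split_ifs with hn
      exacts [by simpa using hB n hn.le, by simpa using hB0]⟩ hv (fun n => by
      rcases lt_trichotomy n (-1) with hn | rfl | hn
      · rw [if_pos (by omega), if_pos (by omega), if_neg (by omega), hu n (by omega)]; simp
      · have := hu (-1) (by omega)
        simp only [Int.reduceNeg, neg_add_cancel] at this
        simp [this]
      · rw [if_neg (by omega), if_neg (by omega), if_neg (by omega)]; simp)
  rw [← hv0, key 0]; simp

theorem exists_forward (hP : IsStableProjection A C r P) (hr0 : 0 ≤ r) (hr1 : r ≤ 1) (e : E) :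
    ∃ u : ℤ → E, (∀ n, 0 ≤ n → u (n + 1) = A n (u n)) ∧ (∃ B, ∀ n, 0 ≤ n → ‖u n‖ ≤ B) ∧
      u 0 = P e := by
  obtain ⟨v, hv, hvb, hv0⟩ := hP e
  obtain ⟨B, hB⟩ := bounded_of_decay hr0 hr1 hvb
  refine ⟨v, fun n hn => ?_, ⟨B, fun n _ => hB n⟩, hv0⟩
  rw [hv, if_neg (by omega), add_zero]

/-- The negative of the response before the forcing is a backward solution. It arrives at `e - P e`
at time `0` because `v 0 = A (-1) (v (-1)) + e`. -/
theorem exists_backward (hP : IsStableProjection A C r P) (hr0 : 0 ≤ r) (hr1 : r ≤ 1) (e : E) :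
    ∃ u : ℤ → E, (∀ n, n < 0 → u (n + 1) = A n (u n)) ∧ (∃ B, ∀ n, n ≤ 0 → ‖u n‖ ≤ B) ∧
      u 0 = e - P e ∧ ∀ n, n < 0 → ‖u n‖ ≤ C * ‖e‖ * r ^ n.natAbs := by
  obtain ⟨v, hv, hvb, hv0⟩ := hP e
  obtain ⟨B, hB⟩ := bounded_of_decay hr0 hr1 hvb
  refine ⟨fun n => if n < 0 then -v n else e - P e, fun n hn => ?_, ⟨B + ‖e - P e‖, fun n _ => ?_⟩,
    by simp, fun n hn => ?_⟩ <;> beta_reduce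
  · rcases lt_or_eq_of_le (Int.le_sub_one_of_lt hn) with hn' | rfl
    · rw [if_pos (by omega), if_pos hn, hv, if_neg (by omega)]; simp
    · have := hv (-1)
      simp only [Int.reduceNeg, neg_add_cancel, if_true] at this
      simp [← hv0, this]
  · have h1 := norm_nonneg (e - P e)
    have h2 := hB n
    have h3 := (norm_nonneg _).trans (hB 0)
    split_ifs
    · rw [norm_neg]; linarith
    · linarith
  · rw [if_pos hn, norm_neg]; exact hvb n

theorem idempotent (hP : IsStableProjection A C r P) (h : IsDichotomy A M) (hr0 : 0 ≤ r)
    (hr1 : r ≤ 1) (e : E) : P (P e) = P e := by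
  obtain ⟨u, hu, hb, hu0⟩ := hP.exists_forward hr0 hr1 e
  rw [← hu0]
  exact (hP.apply_of_forward h hr0 hr1 hu hb).1

/-- `A 0` carries the forward solution through `P e` and the backward solution through `e - P e` to
solutions of the shifted equation. `P'` fixes the first image and kills the second. -/
theorem map_apply {P' : E →L[ℂ] E} {A' : ℤ → E →L[ℂ] E} (hP : IsStableProjection A C r P)
    (hP' : IsStableProjection A' C r P') (hA : ∀ n, A' n = A (n + 1)) (h : IsDichotomy A M)
    (hr0 : 0 ≤ r) (hr1 : r ≤ 1) (e : E) : A 0 (P e) = P' (A 0 e) := by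
  have h' : IsDichotomy A' M := by
    have := h.shift 1
    rwa [show (fun n => A (n + 1)) = A' from funext fun n => (hA n).symm] at this
  obtain ⟨u, hu, ⟨B, hB⟩, hu0⟩ := hP.exists_forward hr0 hr1 e
  obtain ⟨w, hw, ⟨B', hB'⟩, hw0, -⟩ := hP.exists_backward hr0 hr1 e
  have h1 := (hP'.apply_of_forward h' hr0 hr1 (u := fun n => u (n + 1))
    (fun n hn => by rw [hA, hu _ (by omega)]) ⟨B, fun n hn => hB _ (by omega)⟩).1
  -- The sequence `w` is a solution only up to time `0`, so its next value is set to `A 0 (w 0)`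
  -- instead of `w 1`.
  have h2 := hP'.apply_of_backward h' hr0 hr1 (u := fun n => if n < 0 then w (n + 1) else A 0 (w 0))
    (fun n hn => by
      rw [hA, if_pos hn]
      rcases lt_or_eq_of_le (Int.le_sub_one_of_lt hn) with hn' | rfl
      · rw [if_pos (by omega), hw _ (by omega)]
      · simp)
    ⟨B' + ‖A 0 (w 0)‖, fun n _ => by
      have h3 := (norm_nonneg _).trans (hB' 0 le_rfl)
      have h4 := norm_nonneg (A 0 (w 0))
      split_ifs with hn
      · linarith [hB' (n + 1) (by omega)]
      · linarith⟩
  simp only [lt_self_iff_false, if_false, zero_add] at h1 h2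
  have hu1 := hu 0 le_rfl
  rw [zero_add] at hu1
  rw [hu1, hu0] at h1
  rw [hw0, map_sub, map_sub, h1, sub_eq_zero] at h2
  exact h2.symm

/-- Nearby dichotomies have nearby stable projections. -/
theorem norm_sub_le {P' : E →L[ℂ] E} {A' : ℤ → E →L[ℂ] E} (hP : IsStableProjection A C r P)
    (hP' : IsStableProjection A' C r P') (h : IsDichotomy A M) (hM : 0 ≤ M) (hr0 : 0 ≤ r)
    (hr1 : r ≤ 1) {η : ℝ} (hη : ∀ n, ‖A' n - A n‖ * (C * r ^ n.natAbs) ≤ η) : ‖P' - P‖ ≤ M * η := by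
  -- No sign of `C` is assumed; a negative `C` is possible only in the zero space.
  have hC0 : 0 ≤ C ∨ ∀ e : E, e = 0 := by
    by_contra! hcon
    obtain ⟨hC, e, he⟩ := hcon
    obtain ⟨v, -, hv, -⟩ := hP e
    have := (norm_nonneg _).trans (hv 0)
    have he' : 0 < ‖e‖ := norm_pos_iff.2 he
    simp at this
    nlinarith
  rcases hC0 with hC0 | hE
  swap
  · rw [show P' - P = 0 from ContinuousLinearMap.ext fun e => hE _, norm_zero]
    have h0 := hη 0
    rcases le_or_gt 0 η with h1 | h1
    · positivity
    · exfalso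
      rw [show A' 0 - A 0 = 0 from ContinuousLinearMap.ext fun e => hE _] at h0
      simp at h0
      linarith
  have hη0 : 0 ≤ η := le_trans (by positivity) (hη 0)
  refine ContinuousLinearMap.opNorm_le_bound _ (by positivity) fun e => ?_
  obtain ⟨v, hv, hvb, hv0⟩ := hP e
  obtain ⟨v', hv', hvb', hv0'⟩ := hP' e
  obtain ⟨B, hB⟩ := bounded_of_decay hr0 hr1 hvb
  obtain ⟨B', hB'⟩ := bounded_of_decay hr0 hr1 hvb'
  -- The difference of the two responses solves the `A`-equation with forcing `(A' n - A n) (v' n)`.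
  -- The decay of `v'` discounts differences at distant times, hence the weight in `hη`.
  have := h.norm_le (f := fun n => (A' n - A n) (v' n)) (v := fun n => v' n - v n) (B := η * ‖e‖)
    (fun n => by
      calc _ ≤ ‖A' n - A n‖ * ‖v' n‖ := ContinuousLinearMap.le_opNorm _ _
        _ ≤ ‖A' n - A n‖ * (C * ‖e‖ * r ^ n.natAbs) :=
          mul_le_mul_of_nonneg_left (hvb' n) (norm_nonneg _)
        _ = ‖A' n - A n‖ * (C * r ^ n.natAbs) * ‖e‖ := by ring
        _ ≤ _ := mul_le_mul_of_nonneg_right (hη n) (norm_nonneg _))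
    ⟨B' + B, fun n => (_root_.norm_sub_le _ _).trans (add_le_add (hB' n) (hB n))⟩
    (fun n => by rw [hv, hv', map_sub, sub_apply]; abel) 0
  rw [sub_apply, ← hv0, ← hv0', mul_assoc]
  exact this

end IsStableProjection

end Projection

/-! ### Derivatives of iterates -/

section Iterates

variable {p : ℂ × ℂ} (hp : p.1 ≠ 0)

theorem differentiable_henonPerm_zpow (k : ℤ) : Differentiable ℂ ⇑(henonPerm p hp ^ k) := by
  have h1 : Differentiable ℂ ⇑(henonPerm p hp) := fun z => (hasFDerivAt_henon p z).differentiableAt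
  have h2 : Differentiable ℂ ⇑(henonPerm p hp)⁻¹ := by
    change Differentiable ℂ fun z : ℂ × ℂ => (z.2, (z.2 ^ 2 + p.2 - z.1) / p.1)
    fun_prop
  induction k with
  | zero => simp
  | succ i ih => rw [zpow_add_one]; exact ih.comp h1
  | pred i ih => rw [zpow_sub_one]; exact ih.comp h2

/-- The derivative cocycle. -/
noncomputable def cocycle (k : ℤ) (z : ℂ × ℂ) : ℂ × ℂ →L[ℂ] ℂ × ℂ :=
  fderiv ℂ (⇑(henonPerm p hp ^ k)) z

theorem cocycle_zero (z v : ℂ × ℂ) : cocycle hp 0 z v = v := by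
  simp only [cocycle, zpow_zero]
  change (fderiv ℂ id z) v = v
  rw [fderiv_id]; rfl

theorem cocycle_one (z : ℂ × ℂ) : cocycle hp 1 z = henonDeriv p z := by
  simp only [cocycle, zpow_one]
  exact (hasFDerivAt_henon p z).fderiv

theorem cocycle_add {z : ℤ → ℂ × ℂ} (hz : z ∈ boundedOrbits p) (j k n : ℤ) (v : ℂ × ℂ) :
    cocycle hp (j + k) (z n) v = cocycle hp j (z (n + k)) (cocycle hp k (z n) v) := by
  have h : ⇑(henonPerm p hp ^ (j + k)) = ⇑(henonPerm p hp ^ j) ∘ ⇑(henonPerm p hp ^ k) := by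
    rw [zpow_add]; rfl
  simp only [cocycle]
  rw [h, fderiv_comp _ (differentiable_henonPerm_zpow hp j _) (differentiable_henonPerm_zpow hp k _),
    orbit_eq_zpow hp hz.1]
  rfl

theorem cocycle_solution {z u : ℤ → ℂ × ℂ} (hz : z ∈ boundedOrbits p) (m : ℤ) (k : ℕ)
    (hu : ∀ n, m ≤ n → n < m + k → u (n + 1) = henonDeriv p (z n) (u n)) :
    cocycle hp k (z m) (u m) = u (m + k) := by
  induction k with
  | zero => simpa using cocycle_zero hp _ _
  | succ i ih =>
    push_cast
    rw [add_comm (i : ℤ) 1, cocycle_add hp hz, ih fun n h1 h2 => hu n h1 (by push_cast; omega),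
      cocycle_one, ← hu _ (by omega) (by push_cast; omega)]
    congr 1; ring

theorem cocycle_neg_solution {z u : ℤ → ℂ × ℂ} (hz : z ∈ boundedOrbits p) (m : ℤ) (k : ℕ)
    (hu : ∀ n, m ≤ n → n < m + k → u (n + 1) = henonDeriv p (z n) (u n)) :
    cocycle hp (-k) (z (m + k)) (u (m + k)) = u m := by
  rw [← cocycle_solution hp hz m k hu, ← cocycle_add hp hz, neg_add_cancel, cocycle_zero]

theorem zpow_mem_boundedOrbits {z : ℂ × ℂ} (hz : z ∈ K p) :
    (fun n : ℤ => (henonPerm p hp ^ n) z) ∈ boundedOrbits p := by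
  obtain ⟨-, w, hw, rfl⟩ := mem_K_iff.1 hz
  have : (fun n : ℤ => (henonPerm p hp ^ n) (w 0)) = w := by
    funext n
    rw [← orbit_eq_zpow hp hw.1, zero_add]
  rwa [this]

end Iterates

/-- The projections onto the stable bundle are the stable projections along orbits. They depend
continuously on the point because distant times are exponentially discounted, and finitely many
iterates are continuous. -/
theorem OrbitHyperbolic.isUniformlyHyperbolicOn {p : ℂ × ℂ} {M : ℝ} (h : OrbitHyperbolic p M) :
    IsUniformlyHyperbolicOn (henonPerm p h.ne_zero) (K p) := by
  have hp := h.ne_zero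
  have hM := h.one_le
  let O : ℂ × ℂ → ℤ → ℂ × ℂ := fun z n => (henonPerm p hp ^ n) z
  have hO : ∀ z ∈ K p, O z ∈ boundedOrbits p := fun z hz => zpow_mem_boundedOrbits hp hz
  have hO0 : ∀ z, O z 0 = z := fun z => by simp [O]
  set S := 1 + 2 * escapeRadius p + ‖p‖ with hS
  have hS0 : 0 < S := by
    have := one_le_escapeRadius p
    have := norm_nonneg p
    linarith
  have hAS : ∀ z ∈ K p, ∀ n, ‖henonDeriv p (O z n)‖ ≤ S := fun z hz n => by
    have := norm_henonDeriv_le p (O z n)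
    linarith [norm_le_escapeRadius (hO z hz) n]
  -- The rate makes `M * ((q - 1) * S)` equal to `1 / 2`.
  set q := 1 + 1 / (2 * M * S) with hq
  have hq1 : 1 < q := by rw [hq]; simp; positivity
  have hqS : M * ((q - 1) * S) ≤ 1 / 2 := by rw [hq, add_sub_cancel_left]; field_simp; norm_num
  have hr0 : 0 < q⁻¹ := by positivity
  have hr1 : q⁻¹ < 1 := inv_lt_one_of_one_lt₀ hq1
  have hd : ∀ z ∈ K p, IsDichotomy (fun n => henonDeriv p (O z n)) M := fun z hz =>
    h.dichotomy _ (hO z hz)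
  have hex : ∀ z ∈ K p, ∃ P, IsStableProjection (fun n => henonDeriv p (O z n)) (2 * M) q⁻¹ P :=
    fun z hz => (hd z hz).exists_isStableProjection (by linarith) (hAS z hz) hq1.le hqS
  choose! P hP using hex
  have hfd : ∀ z, fderiv ℂ (⇑(henonPerm p hp)) z = henonDeriv p z := fun z =>
    (hasFDerivAt_henon p z).fderiv
  refine ⟨P, ?_, fun z hz v => (hP z hz).idempotent (hd z hz) hr0.le hr1.le v, fun z hz v => ?_,
    2 * M, by linarith, q⁻¹, hr0, hr1, fun z hz n => ⟨fun v hv => ?_, fun v hv => ?_⟩⟩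
  · intro z hz
    rw [ContinuousWithinAt, tendsto_iff_norm_sub_tendsto_zero]
    refine (tendsto_order.2 ⟨fun a ha => .of_forall fun _ => ha.trans_le (norm_nonneg _),
      fun a ha => ?_⟩)
    have hR := one_le_escapeRadius p
    set η := a / (2 * M) with hη
    have hη0 : 0 < η := by positivity
    -- Beyond time `N` the a priori bound on orbits together with the factor `q⁻¹ ^ N` keeps the
    -- weighted difference below `η`; up to time `N` continuity is used.
    obtain ⟨N, hN⟩ := exists_pow_lt_of_lt_one
      (show 0 < η / (2 * (2 * escapeRadius p) * (2 * M)) by positivity) hr1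
    have hev : ∀ᶠ z' in nhdsWithin z (K p), ∀ n ∈ Finset.Icc (-(N : ℤ)) N,
        2 * ‖O z' n - O z n‖ * (2 * M) < η := by
      rw [Filter.eventually_all_finset]
      intro n _
      have hc : Continuous fun z' => 2 * ‖O z' n - O z n‖ * (2 * M) := by
        have := (differentiable_henonPerm_zpow hp n).continuous
        fun_prop
      exact ((hc.tendsto' z 0 (by simp)).eventually_lt_const hη0).filter_mono nhdsWithin_le_nhds
    filter_upwards [hev, self_mem_nhdsWithin] with z' hz' hzK
    have := (hP z hz).norm_sub_le (hP z' hzK) (hd z hz) (by linarith) hr0.le hr1.le (η := η)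
      (fun n => ?_)
    · refine this.trans_lt ?_
      rw [hη]; field_simp; linarith
    · have h1 := norm_henonDeriv_sub_le p p (O z n) (O z' n)
      rw [sub_self, norm_zero, add_zero] at h1
      by_cases hn : n ∈ Finset.Icc (-(N : ℤ)) N
      · refine le_trans ?_ (hz' n hn).le
        have h2 : q⁻¹ ^ n.natAbs ≤ 1 := pow_le_one₀ hr0.le hr1.le
        exact mul_le_mul h1 (mul_le_of_le_one_right (by linarith) h2) (by positivity) (by positivity)
      · have h2 : q⁻¹ ^ n.natAbs ≤ q⁻¹ ^ N := by
          refine pow_le_pow_of_le_one hr0.le hr1.le ?_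
          simp only [Finset.mem_Icc, not_and_or, not_le] at hn
          omega
        have h3 : ‖O z' n - O z n‖ ≤ 2 * escapeRadius p := by
          have := norm_sub_le (O z' n) (O z n)
          linarith [norm_le_escapeRadius (hO z hz) n, norm_le_escapeRadius (hO z' hzK) n]
        calc _ ≤ (2 * (2 * escapeRadius p)) * (2 * M * q⁻¹ ^ N) := by
              refine mul_le_mul (h1.trans (by linarith)) ?_ (by positivity) (by positivity)
              exact mul_le_mul_of_nonneg_left h2 (by linarith)
          _ ≤ (2 * (2 * escapeRadius p)) *
              (2 * M * (η / (2 * (2 * escapeRadius p) * (2 * M)))) := by gcongr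
          _ = η := by field_simp
  · have hz' : henonPerm p hp z ∈ K p := henon_mem_K p hz
    have := (hP z hz).map_apply (hP _ hz') (fun n => by
      simp only [O]
      rw [← Equiv.Perm.mul_apply, ← zpow_add_one]) (hd z hz) hr0.le hr1.le v
    simp only [hO0] at this
    rw [hfd]
    exact this
  · obtain ⟨u, hu, hub, hu0⟩ := hP z hz v
    rw [hv] at hu0
    have h1 := cocycle_solution hp (hO z hz) (u := u) 0 n (fun k hk _ => by
      rw [hu, if_neg (by omega), add_zero])
    rw [hO0, hu0, zero_add] at h1
    simp only [cocycle, zpow_natCast] at h1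
    rw [h1]
    have := hub n
    simp only [Int.natAbs_natCast] at this
    calc _ ≤ _ := this
      _ = _ := by ring
  · obtain ⟨u, hu, -, hu0, hub⟩ := (hP z hz).exists_backward hr0.le hr1.le v
    rw [hv, sub_zero] at hu0
    have h1 := cocycle_neg_solution hp (hO z hz) (u := u) (-n) n (fun k _ hk => hu k (by omega))
    rw [neg_add_cancel, hO0, hu0] at h1
    simp only [cocycle, zpow_neg, zpow_natCast] at h1
    rw [h1]
    -- The decay bound holds at negative times only. For `n = 0` the estimate follows from `1 ≤ M`.
    rcases Nat.eq_zero_or_pos n with rfl | hn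
    · have := norm_nonneg v
      simp only [Nat.cast_zero, neg_zero, hu0, pow_zero, mul_one]
      nlinarith
    · have := hub (-n) (by omega)
      simp only [Int.natAbs_neg, Int.natAbs_natCast] at this
      calc _ ≤ _ := this
        _ = _ := by ring

/-! ### From invariant splittings to dichotomies -/

theorem norm_tsum_le_geometric {E : Type*} [NormedAddCommGroup E] [CompleteSpace E] {f : ℕ → E}
    {c r : ℝ} (hr0 : 0 ≤ r) (hr1 : r < 1) (hf : ∀ k, ‖f k‖ ≤ c * r ^ k) :
    Summable f ∧ ‖∑' k, f k‖ ≤ c / (1 - r) := by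
  have hs : Summable fun k => c * r ^ k := (summable_geometric_of_lt_one hr0 hr1).mul_left c
  refine ⟨.of_norm_bounded hs hf, tsum_of_norm_bounded ?_ hf⟩
  rw [div_eq_mul_inv]
  exact (hasSum_geometric_of_lt_one hr0 hr1).mul_left c

/-- The bounded solution is given by Green's formula: stable parts of past forcings pushed forward,
minus unstable parts of future forcings pulled back. A bounded homogeneous solution vanishes since
its stable part comes from arbitrarily far in the past and its unstable part from arbitrarily far in
the future. Compactness bounds the projections. -/
theorem IsUniformlyHyperbolicOn.exists_orbitHyperbolic {p : ℂ × ℂ} (hp : p.1 ≠ 0)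
    (h : IsUniformlyHyperbolicOn (henonPerm p hp) (K p)) (hK : IsCompact (K p)) :
    ∃ M, OrbitHyperbolic p M := by
  obtain ⟨P, hPc, hPP, hPD, C, hC, r, hr0, hr1, hest⟩ := h
  obtain ⟨b₀, hb⟩ := hK.exists_bound_of_continuousOn hPc
  have hfd : ∀ z, fderiv ℂ (⇑(henonPerm p hp)) z = henonDeriv p z := fun z =>
    (hasFDerivAt_henon p z).fderiv
  simp only [hfd] at hPD
  set b := max b₀ 0 with hb'
  have hb0 : 0 ≤ b := le_max_right _ _
  have hPn : ∀ z ∈ K p, ∀ v, ‖P z v‖ ≤ b * ‖v‖ := fun z hz v =>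
    ((P z).le_opNorm v).trans (mul_le_mul_of_nonneg_right ((hb z hz).trans (le_max_left _ _))
      (norm_nonneg _))
  have hQn : ∀ z ∈ K p, ∀ v, ‖v - P z v‖ ≤ (1 + b) * ‖v‖ := fun z hz v =>
    (norm_sub_le _ _).trans (by linarith [hPn z hz v])
  have hs : ∀ z ∈ K p, ∀ (k : ℕ) v, ‖cocycle hp k z (P z v)‖ ≤ C * r ^ k * (b * ‖v‖) := by
    intro z hz k v
    have := (hest z hz k).1 _ (hPP z hz v)
    rw [← zpow_natCast] at this
    exact this.trans (mul_le_mul_of_nonneg_left (hPn z hz v) (by positivity))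
  have hu : ∀ z ∈ K p, ∀ (k : ℕ) v,
      ‖cocycle hp (-k) z (v - P z v)‖ ≤ C * r ^ k * ((1 + b) * ‖v‖) := by
    intro z hz k v
    have := (hest z hz k).2 (v - P z v) (by rw [map_sub, hPP z hz, sub_self])
    rw [← zpow_natCast, ← zpow_neg] at this
    exact this.trans (mul_le_mul_of_nonneg_left (hQn z hz v) (by positivity))
  set M := C * b / (1 - r) + C * (1 + b) / (1 - r) with hM
  refine ⟨max 1 M, hp, le_max_left _ _, fun z hz => IsDichotomy.mono ⟨fun f B hf => ?_,
    fun v hv hv' m => ?_⟩ (le_max_right _ _)⟩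
  · have hB : 0 ≤ B := (norm_nonneg _).trans (hf 0)
    have hzK := fun n => apply_mem_K hp hz n
    let s : ℤ → ℕ → ℂ × ℂ := fun n k =>
      cocycle hp k (z (n - k)) (P (z (n - k)) (f (n - k - 1)))
    let t : ℤ → ℕ → ℂ × ℂ := fun n k =>
      cocycle hp (-(k + 1 : ℕ)) (z (n + k + 1)) (f (n + k) - P (z (n + k + 1)) (f (n + k)))
    have hsb : ∀ n k, ‖s n k‖ ≤ C * b * B * r ^ k := fun n k => by
      refine (hs _ (hzK _) k _).trans ?_
      calc _ ≤ C * r ^ k * (b * B) := by gcongr; exact hf _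
        _ = _ := by ring
    have htb : ∀ n k, ‖t n k‖ ≤ C * (1 + b) * B * r ^ k := fun n k => by
      refine (hu _ (hzK _) (k + 1) _).trans ?_
      have hrk : r ^ (k + 1) ≤ r ^ k := pow_le_pow_of_le_one hr0.le hr1.le (Nat.le_succ k)
      calc _ ≤ C * r ^ k * ((1 + b) * B) := by gcongr; exact hf _
        _ = _ := by ring
    have hss := fun n => norm_tsum_le_geometric hr0.le hr1 (hsb n)
    have hts := fun n => norm_tsum_le_geometric hr0.le hr1 (htb n)
    have h1 : ∀ n, ∑' k, s (n + 1) k = henonDeriv p (z n) (∑' k, s n k) + P (z (n + 1)) (f n) := by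
      intro n
      rw [(hss (n + 1)).1.tsum_eq_zero_add, (henonDeriv p (z n)).map_tsum (hss n).1, add_comm]
      congr 1
      · refine tsum_congr fun k => ?_
        have e : n + 1 - ((k + 1 : ℕ) : ℤ) = n - k := by push_cast; ring
        simp only [s]
        rw [e, show ((k + 1 : ℕ) : ℤ) = 1 + k by push_cast; ring, cocycle_add hp hz, cocycle_one,
          sub_add_cancel]
      · simp only [s, Nat.cast_zero, sub_zero, add_sub_cancel_right]
        exact cocycle_zero hp _ _
    have h2 : ∀ n, ∑' k, t (n + 1) k
        = henonDeriv p (z n) (∑' k, t n k) - (f n - P (z (n + 1)) (f n)) := by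
      intro n
      have h3 : ∀ k, henonDeriv p (z n) (t n k)
          = cocycle hp (-k) (z (n + k + 1)) (f (n + k) - P (z (n + k + 1)) (f (n + k))) := by
        intro k
        have e : n = n + k + 1 + -((k + 1 : ℕ) : ℤ) := by push_cast; ring
        have e' : -(k : ℤ) = 1 + -((k + 1 : ℕ) : ℤ) := by push_cast; ring
        rw [e', cocycle_add hp hz, ← e, cocycle_one]
      have hsm : Summable fun k => henonDeriv p (z n) (t n k) :=
        (henonDeriv p (z n)).summable (hts n).1
      rw [(henonDeriv p (z n)).map_tsum (hts n).1, hsm.tsum_eq_zero_add, h3 0]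
      simp only [Nat.cast_zero, add_zero, neg_zero]
      rw [cocycle_zero, add_sub_cancel_left]
      refine tsum_congr fun k => ?_
      rw [h3]
      simp only [t]
      rw [show n + ((k + 1 : ℕ) : ℤ) = n + 1 + k by push_cast; ring]
    refine ⟨fun n => ∑' k, s n k - ∑' k, t n k, fun n => ?_, fun n => ?_⟩
    · simp only [h1, h2, map_sub]
      abel
    · calc _ ≤ ‖∑' k, s n k‖ + ‖∑' k, t n k‖ := norm_sub_le _ _
        _ ≤ C * b * B / (1 - r) + C * (1 + b) * B / (1 - r) := add_le_add (hss n).2 (hts n).2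
        _ = M * B := by rw [hM]; ring
  · obtain ⟨B, hB⟩ := hv
    have hzK := fun n => apply_mem_K hp hz n
    have hlim : ∀ c : ℝ, Filter.Tendsto (fun k : ℕ => C * r ^ k * c) Filter.atTop (nhds 0) := by
      intro c
      simpa using ((tendsto_pow_atTop_nhds_zero_of_lt_one hr0.le hr1).const_mul C).mul_const c
    have hPv : ∀ n, P (z (n + 1)) (v (n + 1)) = henonDeriv p (z n) (P (z n) (v n)) := by
      intro n
      rw [hPD _ (hzK n), ← hv', hz.1]
      rfl
    have hPz : P (z m) (v m) = 0 := by
      refine norm_le_zero_iff.1 (ge_of_tendsto' (hlim (b * B)) fun k => ?_)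
      have h1 := cocycle_solution hp hz (u := fun n => P (z n) (v n)) (m - k) k fun n _ _ => hPv n
      simp only [sub_add_cancel] at h1
      rw [← h1]
      refine (hs _ (hzK _) k _).trans ?_
      gcongr
      exact hB _
    have hQz : v m - P (z m) (v m) = 0 := by
      refine norm_le_zero_iff.1 (ge_of_tendsto' (hlim ((1 + b) * B)) fun k => ?_)
      have h1 := cocycle_neg_solution hp hz (u := fun n => v n - P (z n) (v n)) m k
        fun n _ _ => by rw [hPv, hv', map_sub]
      rw [← h1]
      refine (hu _ (hzK _) k _).trans ?_
      gcongr
      exact hB _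
    rwa [hPz, sub_zero] at hQz

/-! ### Families of conjugacies -/

/-- The preimage of a closed set is the projection of a closed subset of the graph, and projection
along a compact factor is a closed map. -/
theorem continuous_of_isClosed_graph {X Y : Type*} [TopologicalSpace X] [TopologicalSpace Y]
    [CompactSpace Y] {f : X → Y} {G : Set (X × Y)} (hG : IsClosed G)
    (h : ∀ x y, (x, y) ∈ G ↔ f x = y) : Continuous f := by
  refine continuous_iff_isClosed.2 fun C hC => ?_
  have := isClosedMap_fst_of_compactSpace _ (hG.inter (hC.preimage continuous_snd))
  convert! this using 1
  ext x
  simp only [mem_preimage, mem_image, mem_inter_iff, Prod.exists, exists_and_right, exists_eq_right]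
  constructor
  · exact fun hx => ⟨f x, (h _ _).2 rfl, hx⟩
  · rintro ⟨y, hy, hyC⟩
    rwa [(h _ _).1 hy]

/-- The powers of the shift. -/
def shiftBy (n : ℤ) (s : Sigma2) : Sigma2 := fun i => s (i + n)

theorem shiftBy_zero (s : Sigma2) : shiftBy 0 s = s := by funext i; simp [shiftBy]

theorem shiftBy_add_one (n : ℤ) (s : Sigma2) : shiftBy (n + 1) s = shift (shiftBy n s) := by
  funext i; simp only [shiftBy, shift]; congr 1; ring

theorem shiftBy_shiftBy (n m : ℤ) (s : Sigma2) : shiftBy n (shiftBy m s) = shiftBy (n + m) s := by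
  funext i; simp only [shiftBy]; congr 1; ring

theorem continuous_shiftBy (n : ℤ) : Continuous (shiftBy n) :=
  continuous_pi fun i => continuous_apply (i + n)

/-- A continuous family of inverses `Σ₂ → K (γ t)` of conjugacies. -/
structure IsShiftFamily {T : Type*} [TopologicalSpace T] (γ : T → ℂ × ℂ)
    (φ : T × Sigma2 → ℂ × ℂ) : Prop where
  continuous : Continuous φ
  bijOn : ∀ t, BijOn (fun s => φ (t, s)) univ (K (γ t))
  semiconj : ∀ t s, φ (t, shift s) = henon (γ t) (φ (t, s))

theorem norm_le_of_mem_K {p z : ℂ × ℂ} (hz : z ∈ K p) : ‖z‖ ≤ escapeRadius p := by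
  obtain ⟨-, w, hw, rfl⟩ := mem_K_iff.1 hz
  exact norm_le_escapeRadius hw 0

/-- With `T = Unit`, results about families apply to a single conjugacy. -/
theorem ShiftConjugacy.isShiftFamily {T : Type*} [TopologicalSpace T] {p : ℂ × ℂ}
    (h : ShiftConjugacy p) :
    IsShiftFamily (fun _ : T => p) fun x => (h.homeo.symm x.2 : ℂ × ℂ) where
  continuous := by fun_prop
  bijOn t := by
    refine ⟨fun s _ => (h.homeo.symm s).2, fun s _ s' _ hs => ?_, fun z hz => ?_⟩
    · exact h.homeo.symm.injective (Subtype.ext hs)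
    · exact ⟨h.homeo ⟨z, hz⟩, mem_univ _, by simp⟩
  semiconj t s := by
    have : h.homeo.symm (shift s) = henonK p (h.homeo.symm s) := by
      rw [Homeomorph.symm_apply_eq, h.semiconj, Homeomorph.apply_symm_apply]
    simp only [this]
    rfl

theorem ConjugacyFamily.isShiftFamily {p q : ℂ × ℂ} {γ : Path p q} (h : ConjugacyFamily γ) :
    IsShiftFamily γ fun x => ((h.conj x.1).homeo.symm x.2 : ℂ × ℂ) where
  continuous := h.continuous_symm
  bijOn t := ((h.conj t).isShiftFamily (T := Unit)).bijOn ()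
  semiconj t := ((h.conj t).isShiftFamily (T := Unit)).semiconj ()

namespace IsShiftFamily

variable {T : Type*} [TopologicalSpace T] {γ : T → ℂ × ℂ} {φ : T × Sigma2 → ℂ × ℂ}

theorem ne_zero (F : IsShiftFamily γ φ) (t : T) : (γ t).1 ≠ 0 :=
  (mem_K_iff.1 ((F.bijOn t).mapsTo (mem_univ (0 : Sigma2)))).1

theorem orbit_mem (F : IsShiftFamily γ φ) (t : T) (s : Sigma2) :
    (fun n => φ (t, shiftBy n s)) ∈ boundedOrbits (γ t) := by
  refine ⟨fun n => ?_, escapeRadius (γ t), fun n =>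
    norm_le_of_mem_K ((F.bijOn t).mapsTo (mem_univ _))⟩
  simp only [shiftBy_add_one, F.semiconj]

/-- The conjugacies of a family. -/
theorem exists_shiftConjugacy (F : IsShiftFamily γ φ) (t : T) :
    ∃ h : ShiftConjugacy (γ t), ∀ s, (h.homeo.symm s : ℂ × ℂ) = φ (t, s) := by
  have hbij : Function.Bijective
      (fun s => (⟨φ (t, s), (F.bijOn t).mapsTo (mem_univ s)⟩ : K (γ t))) := by
    constructor
    · intro s s' hs
      exact (F.bijOn t).injOn (mem_univ _) (mem_univ _) (congrArg Subtype.val hs)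
    · rintro ⟨z, hz⟩
      obtain ⟨s, -, hs⟩ := (F.bijOn t).surjOn hz
      exact ⟨s, Subtype.ext hs⟩
  have hc : Continuous (Equiv.ofBijective _ hbij) := by
    have := F.continuous
    change Continuous (fun s => (⟨φ (t, s), _⟩ : K (γ t)))
    fun_prop
  let H : Sigma2 ≃ₜ K (γ t) := hc.homeoOfEquivCompactToT2
  have hH : ∀ s, (H s : ℂ × ℂ) = φ (t, s) := fun s => rfl
  refine ⟨⟨H.symm, fun z => ?_⟩, hH⟩
  rw [Homeomorph.symm_apply_eq]
  refine Subtype.ext ?_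
  rw [hH, F.semiconj, ← hH, Homeomorph.apply_symm_apply]
  rfl

/-- A family of conjugacies extends to a nearby family of hyperbolic parameters. -/
theorem exists_extension (F : IsShiftFamily γ φ) {γ' : T → ℂ × ℂ} (hγ' : Continuous γ') {M r : ℝ}
    (h : ∀ t, OrbitHyperbolic (γ t) M) (h' : ∀ t, OrbitHyperbolic (γ' t) M)
    (hr : ∀ t, escapeRadius (γ t) ≤ r) (hr' : ∀ t, escapeRadius (γ' t) ≤ r)
    (hd : ∀ t, ‖γ' t - γ t‖ ≤ 1 / (16 * M ^ 2 * (1 + r))) :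
    ∃ φ', IsShiftFamily γ' φ' ∧ ∀ t, γ' t = γ t → ∀ s, φ' (t, s) = φ (t, s) := by
  have hM := fun t => (h t).one_le
  -- Two orbits within `1 / (8 * M)` of the same orbit are within the expansivity distance, so the
  -- shadowing orbit is unique.
  have hε : ∀ t : T, 1 / (8 * M) + 1 / (8 * M) ≤ 1 / (2 * M) := fun t => by
    have := hM t
    field_simp
    norm_num
  choose Y hY hYd using fun t s => (h t).exists_close_orbit (hr t) (hd t) (F.orbit_mem t s)
  have huniq : ∀ t s w, w ∈ boundedOrbits (γ' t) →
      (∀ n, ‖w n - φ (t, shiftBy n s)‖ ≤ 1 / (8 * M)) → Y t s = w := by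
    intro t s w hw hws
    refine (h' t).eq_of_close (hY t s) hw fun n => ?_
    have e : w n - Y t s n = (w n - φ (t, shiftBy n s)) - (Y t s n - φ (t, shiftBy n s)) := by abel
    rw [e]
    exact (norm_sub_le _ _).trans ((add_le_add (hws n) (hYd t s n)).trans (hε t))
  have hshift : ∀ t s k, Y t (shiftBy k s) = fun n => Y t s (n + k) := by
    intro t s k
    refine huniq t _ _ (shift_mem_boundedOrbits (hY t s) k) fun n => ?_
    rw [shiftBy_shiftBy]
    exact hYd t s (n + k)
  refine ⟨fun x => Y x.1 x.2 0, ⟨?_, fun t => ⟨?_, ?_, ?_⟩, fun t s => ?_⟩, fun t ht s => ?_⟩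
  -- By uniqueness the shadowing orbit is characterized by closed conditions. It lies in a compact
  -- product of balls, so the closed graph criterion gives continuity.
  · let B : Set (ℤ → ℂ × ℂ) := Set.pi univ fun _ => Metric.closedBall 0 r
    have hB : IsCompact B := isCompact_univ_pi fun _ => isCompact_closedBall _ _
    have : CompactSpace B := isCompact_iff_compactSpace.1 hB
    have hYB : ∀ t s, Y t s ∈ B := fun t s n _ => by
      rw [mem_closedBall_zero_iff]
      exact (norm_le_escapeRadius (hY t s) n).trans (hr' t)
    let f : T × Sigma2 → B := fun x => ⟨Y x.1 x.2, hYB _ _⟩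
    have hf : Continuous f := by
      refine continuous_of_isClosed_graph (G := {x : (T × Sigma2) × B |
        ∀ n : ℤ, (x.2 : ℤ → ℂ × ℂ) (n + 1) = henon (γ' x.1.1) ((x.2 : ℤ → ℂ × ℂ) n) ∧
          ‖(x.2 : ℤ → ℂ × ℂ) n - φ (x.1.1, shiftBy n x.1.2)‖ ≤ 1 / (8 * M)}) ?_ ?_
      · have hc := F.continuous
        have hev : ∀ m : ℤ, Continuous fun x : (T × Sigma2) × B => (x.2 : ℤ → ℂ × ℂ) m := fun m =>
          (continuous_apply m).comp (continuous_subtype_val.comp continuous_snd)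
        have c1 : ∀ n : ℤ, Continuous fun x : (T × Sigma2) × B =>
            henon (γ' x.1.1) ((x.2 : ℤ → ℂ × ℂ) n) := fun n =>
          continuous_henon (hγ'.comp (continuous_fst.comp continuous_fst)) (hev n)
        have c2 : ∀ n : ℤ, Continuous fun x : (T × Sigma2) × B =>
            ‖(x.2 : ℤ → ℂ × ℂ) n - φ (x.1.1, shiftBy n x.1.2)‖ := fun n =>
          ((hev n).sub (hc.comp ((continuous_fst.comp continuous_fst).prodMk
            ((continuous_shiftBy n).comp (continuous_snd.comp continuous_fst))))).norm
        convert! isClosed_iInter fun n : ℤ => (isClosed_eq (hev (n + 1)) (c1 n)).inter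
          (isClosed_le (c2 n) (continuous_const (y := 1 / (8 * M)))) using 1
        ext x
        simp only [mem_ofPred_eq, mem_iInter, mem_inter_iff]
      · rintro ⟨t, s⟩ ⟨w, hw⟩
        constructor
        · intro hx
          refine Subtype.ext (huniq t s w ⟨fun n => (hx n).1, r, fun n => ?_⟩ fun n => (hx n).2)
          simpa using hw n (mem_univ n)
        · intro hx
          have hx' : Y t s = w := congrArg Subtype.val hx
          subst hx'
          exact fun n => ⟨(hY t s).1 n, hYd t s n⟩
    exact (continuous_apply (0 : ℤ)).comp (continuous_subtype_val.comp hf)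
  · exact fun s _ => apply_mem_K (h' t).ne_zero (hY t s) 0
  · intro s _ s' _ hss
    have e : Y t s = Y t s' := orbit_ext (h' t).ne_zero (hY t s).1 (hY t s').1 0 hss
    have e' := (h t).eq_of_close (F.orbit_mem t s) (F.orbit_mem t s') fun n => by
      have e2 : φ (t, shiftBy n s') - φ (t, shiftBy n s)
          = (Y t s n - φ (t, shiftBy n s)) - (Y t s' n - φ (t, shiftBy n s')) := by rw [e]; abel
      rw [e2]
      exact (norm_sub_le _ _).trans ((add_le_add (hYd t s n) (hYd t s' n)).trans (hε t))
    have e0 := congrFun e' 0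
    simp only [shiftBy_zero] at e0
    exact (F.bijOn t).injOn (mem_univ _) (mem_univ _) e0
  · intro w hw
    obtain ⟨-, z, hz, rfl⟩ := mem_K_iff.1 hw
    -- Surjectivity exchanges the two parameters: an orbit for `γ' t` is followed by one for `γ t`,
    -- whose code is the required `s`.
    obtain ⟨z', hz', hzz'⟩ := (h' t).exists_close_orbit (p' := γ t) (hr' t)
      (by rw [norm_sub_rev]; exact hd t) hz
    obtain ⟨s, -, hs⟩ := (F.bijOn t).surjOn (apply_mem_K (h t).ne_zero hz' 0)
    have e : (fun n => φ (t, shiftBy n s)) = z' :=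
      orbit_ext (h t).ne_zero (F.orbit_mem t s).1 hz'.1 0 (by simpa [shiftBy_zero] using hs)
    refine ⟨s, mem_univ _, ?_⟩
    have e2 := huniq t s z hz fun n => by
      rw [norm_sub_rev, show φ (t, shiftBy n s) = z' n from congrFun e n]; exact hzz' n
    exact congrFun e2 0
  · have := hshift t s 1
    rw [← zero_add (1 : ℤ), shiftBy_add_one, shiftBy_zero] at this
    simp only [this, zero_add]
    exact (hY t s).1 0
  · have hpos : 0 ≤ 1 / (8 * M) := (norm_nonneg _).trans (hYd t s 0)
    have := huniq t s _ (by rw [ht]; exact F.orbit_mem t s) fun n => by simpa using hpos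
    simp only [this, shiftBy_zero]

/-- Two families over the same hyperbolic parameters that agree at one point agree along it. -/
theorem eq_of_eq [PreconnectedSpace T] (F : IsShiftFamily γ φ) {ψ : T × Sigma2 → ℂ × ℂ}
    (G : IsShiftFamily γ ψ)
    (hyp : ∀ t₀, ∃ M, ∀ᶠ t in nhds t₀, OrbitHyperbolic (γ t) M) {s s' : Sigma2} {t₀ : T}
    (h : φ (t₀, s) = ψ (t₀, s')) (t : T) : φ (t, s) = ψ (t, s') := by
  have hφ := F.continuous
  have hψ := G.continuous
  have hclopen : IsClopen {t | φ (t, s) = ψ (t, s')} := by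
    refine ⟨isClosed_eq (by fun_prop) (by fun_prop), isOpen_iff_mem_nhds.2 fun t₁ ht₁ => ?_⟩
    obtain ⟨M, hM⟩ := hyp t₁
    have hpos : 0 < 1 / (2 * M) := by
      have := hM.self_of_nhds.one_le
      positivity
    let C : Set (Sigma2 × Sigma2) := {x | φ (t₁, x.1) = ψ (t₁, x.2)}
    have hC : IsCompact C := (isClosed_eq (by fun_prop) (by fun_prop)).isCompact
    -- The orbits agree at `t₁`, so every pair of simultaneous shifts of `s` and `s'` lies in the
    -- compact set `C`. One neighbourhood of `t₁` thus controls all times of the orbits at once, and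
    -- expansivity makes the agreement set open.
    have hev : ∀ᶠ t in nhds t₁, ∀ x ∈ C, ‖ψ (t, x.2) - φ (t, x.1)‖ < 1 / (2 * M) := by
      refine hC.eventually_forall_of_forall_eventually fun x hx => ?_
      have hcont : Continuous fun y : T × (Sigma2 × Sigma2) =>
          ‖ψ (y.1, y.2.2) - φ (y.1, y.2.1)‖ := by fun_prop
      refine (hcont.tendsto' (t₁, x) 0 ?_).eventually_lt_const hpos
      have hx' : φ (t₁, x.1) = ψ (t₁, x.2) := hx
      simp [hx']
    have horb : (fun n => φ (t₁, shiftBy n s)) = fun n => ψ (t₁, shiftBy n s') :=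
      orbit_ext (F.ne_zero t₁) (F.orbit_mem t₁ s).1 (G.orbit_mem t₁ s').1 0 (by simpa [shiftBy_zero] using ht₁)
    filter_upwards [hev, hM] with t ht htM
    have e := htM.eq_of_close (F.orbit_mem t s) (G.orbit_mem t s') fun n =>
      (ht (shiftBy n s, shiftBy n s') (congrFun horb n)).le
    simpa [shiftBy_zero] using congrFun e 0
  have := hclopen.eq_univ ⟨t₀, h⟩
  exact (this ▸ mem_univ t : t ∈ {t | φ (t, s) = ψ (t, s')})

/-- Continuation along a path in a uniformly hyperbolic region. -/
theorem exists_continuation {γ : I → ℂ × ℂ} (hγ : Continuous γ) {M r : ℝ}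
    (hyp : ∀ t, OrbitHyperbolic (γ t) M) (hr : ∀ t, escapeRadius (γ t) ≤ r)
    (h0 : ShiftConjugacy (γ 0)) :
    ∃ φ, IsShiftFamily γ φ ∧ ∀ s, φ (0, s) = h0.homeo.symm s := by
  have hM := (hyp 0).one_le
  have hr1 := (one_le_escapeRadius _).trans (hr 0)
  set d := 1 / (16 * M ^ 2 * (1 + r)) with hd
  have hd0 : 0 < d := by positivity
  obtain ⟨η, hη, hu⟩ := Metric.uniformContinuous_iff.1
    (CompactSpace.uniformContinuous_of_continuous hγ) d hd0
  obtain ⟨N, hN⟩ := exists_nat_one_div_lt hη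
  have hN0 : (0 : ℝ) < N + 1 := by positivity
  let τ : ℕ → I := fun i => projIcc 0 1 zero_le_one (i / (N + 1))
  have hτ : ∀ i t, dist (min t (τ (i + 1))) (min t (τ i)) < η := by
    intro i t
    refine lt_of_le_of_lt ?_ hN
    have h1 : dist (min t (τ (i + 1))) (min t (τ i)) ≤ |(τ (i + 1) : ℝ) - τ i| := by
      rw [Subtype.dist_eq, Real.dist_eq]
      have hmin : ∀ a b : I, ((min a b : I) : ℝ) = min (a : ℝ) b := fun a b =>
        (Subtype.mono_coe _).map_min
      rw [hmin, hmin]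
      refine (abs_min_sub_min_le_max _ _ _ _).trans ?_
      simp
    refine h1.trans ?_
    have h2 := abs_projIcc_sub_projIcc (h := zero_le_one (α := ℝ)) (c := ((i + 1 : ℕ) : ℝ) / (N + 1))
      (d := (i : ℝ) / (N + 1))
    refine h2.trans (le_of_eq ?_)
    rw [← sub_div]
    push_cast
    rw [add_sub_cancel_left, abs_of_pos (by positivity)]
  -- Stopping the path at time `τ i` makes each stage a family over the whole interval, so no gluing
  -- is needed.
  have key : ∀ i, ∃ φ, IsShiftFamily (fun t => γ (min t (τ i))) φ ∧
      ∀ s, φ (0, s) = h0.homeo.symm s := by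
    intro i
    induction i with
    | zero =>
      have : (fun t => γ (min t (τ 0))) = fun _ => γ 0 := by
        funext t
        have : τ 0 = 0 := by simp [τ]
        rw [this, min_eq_right (show 0 ≤ t from t.2.1)]
      rw [this]
      exact ⟨_, h0.isShiftFamily, fun s => rfl⟩
    | succ i ih =>
      obtain ⟨φ, F, hφ⟩ := ih
      obtain ⟨φ', F', hφ'⟩ := F.exists_extension (γ' := fun t => γ (min t (τ (i + 1))))
        (hγ.comp (continuous_id.min continuous_const)) (M := M) (r := r)
        (fun t => hyp _) (fun t => hyp _) (fun t => hr _) (fun t => hr _) (fun t => by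
          rw [← dist_eq_norm]; exact (hu (hτ i t)).le)
      refine ⟨φ', F', fun s => ?_⟩
      rw [hφ' 0 _ s, hφ]
      rw [min_eq_left (show 0 ≤ τ (i + 1) from (τ (i + 1)).2.1),
        min_eq_left (show 0 ≤ τ i from (τ i).2.1)]
  have hlast : (fun t => γ (min t (τ (N + 1)))) = γ := by
    funext t
    have : τ (N + 1) = 1 := by
      simp only [τ]
      push_cast
      rw [div_self hN0.ne']
      exact projIcc_right _
    rw [this, min_eq_left (show t ≤ 1 from t.2.2)]
  have := key (N + 1)
  rwa [hlast] at this

end IsShiftFamily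

/-! ### Openness of the horseshoe locus -/

theorem ShiftConjugacy.isCompact {p : ℂ × ℂ} (h : ShiftConjugacy p) : IsCompact (K p) :=
  isCompact_iff_compactSpace.2 h.homeo.symm.compactSpace

theorem ShiftConjugacy.ne_zero {p : ℂ × ℂ} (h : ShiftConjugacy p) : p.1 ≠ 0 :=
  (h.isShiftFamily (T := Unit)).ne_zero ()

theorem mem_horseshoeLocus_iff {p : ℂ × ℂ} :
    p ∈ horseshoeLocus ↔ (∃ M, OrbitHyperbolic p M) ∧ Nonempty (ShiftConjugacy p) := by
  constructor
  · rintro ⟨⟨hp, h⟩, ⟨c⟩⟩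
    exact ⟨h.exists_orbitHyperbolic hp c.isCompact, ⟨c⟩⟩
  · rintro ⟨⟨M, h⟩, hc⟩
    exact ⟨⟨h.ne_zero, h.isUniformlyHyperbolicOn⟩, hc⟩

/-- Finite pieces of bounded orbits depend semicontinuously on the parameter. -/
theorem eventually_close_on_finset (p₀ : ℂ × ℂ) (J : Finset ℤ) {ε : ℝ} (hε : 0 < ε) :
    ∀ᶠ p in nhds p₀, ∀ w ∈ boundedOrbits p, ∃ z ∈ boundedOrbits p₀, ∀ j ∈ J, ‖w j - z j‖ < ε := by
  obtain ⟨r, hr⟩ := ((isCompact_closedBall p₀ 1).image continuous_escapeRadius).bddAbove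
  let D : Set ((ℂ × ℂ) × (ℤ → ℂ × ℂ)) :=
    (Metric.closedBall p₀ 1 ×ˢ Set.pi univ fun _ => Metric.closedBall 0 r) ∩
      {x | ∀ n, x.2 (n + 1) = henon x.1 (x.2 n)}
  let V : Set ((ℂ × ℂ) × (ℤ → ℂ × ℂ)) :=
    {x | ∃ z ∈ boundedOrbits p₀, ∀ j ∈ J, ‖x.2 j - z j‖ < ε}
  have hD : IsCompact D := by
    refine ((isCompact_closedBall _ _).prod (isCompact_univ_pi fun _ =>
      isCompact_closedBall _ _)).inter_right ?_
    have hev : ∀ m : ℤ, Continuous fun x : (ℂ × ℂ) × (ℤ → ℂ × ℂ) => x.2 m := fun m =>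
      (continuous_apply m).comp continuous_snd
    have c1 : ∀ n : ℤ, Continuous fun x : (ℂ × ℂ) × (ℤ → ℂ × ℂ) => henon x.1 (x.2 n) := fun n =>
      continuous_henon continuous_fst (hev n)
    convert! isClosed_iInter fun n : ℤ => isClosed_eq (hev (n + 1)) (c1 n) using 1
    ext x
    simp only [mem_ofPred_eq, mem_iInter]
  have hV : IsOpen V := by
    have : V = ⋃ z ∈ boundedOrbits p₀, ⋂ j ∈ J, {x | ‖x.2 j - z j‖ < ε} := by
      ext x; simp [V]
    rw [this]
    refine isOpen_biUnion fun z _ => isOpen_biInter_finset fun j _ => isOpen_lt ?_ continuous_const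
    exact (((continuous_apply j).comp continuous_snd).sub continuous_const).norm
  -- The pairs of a parameter and a bounded orbit that violate the claim form a compact set, so
  -- their parameters form a closed set, which misses `p₀`.
  have hcl : IsClosed (Prod.fst '' (D \ V)) := ((hD.diff hV).image continuous_fst).isClosed
  have hp₀ : p₀ ∉ Prod.fst '' (D \ V) := by
    rintro ⟨⟨p, w⟩, ⟨⟨⟨-, hw⟩, ho⟩, hV⟩, rfl⟩
    refine hV ⟨w, ⟨ho, r, fun n => ?_⟩, fun j _ => by simpa using hε⟩
    simpa using hw n (mem_univ n)
  filter_upwards [hcl.isOpen_compl.mem_nhds hp₀, Metric.closedBall_mem_nhds p₀ one_pos] with p hp hpb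
  intro w hw
  by_contra hcon
  refine hp ⟨(p, w), ⟨⟨⟨hpb, fun n _ => ?_⟩, hw.1⟩, hcon⟩, rfl⟩
  rw [mem_closedBall_zero_iff]
  exact (norm_le_escapeRadius hw n).trans (hr ⟨p, hpb, rfl⟩)

/-- If the dynamics on the bounded orbits is a full shift, bounded orbits of nearby maps are
shadowed. -/
theorem ShiftConjugacy.eventually_shadowed {p₀ : ℂ × ℂ} (h : ShiftConjugacy p₀) {ε : ℝ}
    (hε : 0 < ε) :
    ∀ᶠ p in nhds p₀, ∀ w ∈ boundedOrbits p, ∃ z ∈ boundedOrbits p₀, ∀ n, ‖w n - z n‖ ≤ ε := by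
  have F := h.isShiftFamily (T := Unit)
  let φ : Sigma2 → ℂ × ℂ := fun s => h.homeo.symm s
  have hφ : Continuous φ := by fun_prop
  have hφo : ∀ s, (fun n => φ (shiftBy n s)) ∈ boundedOrbits p₀ := fun s => F.orbit_mem () s
  have hφi : ∀ s s', φ s = φ s' → s = s' := fun s s' hs =>
    (F.bijOn ()).injOn (mem_univ _) (mem_univ _) hs
  have hφs : ∀ z ∈ boundedOrbits p₀, ∃ s, ∀ n, z n = φ (shiftBy n s) := by
    intro z hz
    obtain ⟨s, -, hs⟩ := (F.bijOn ()).surjOn (apply_mem_K h.ne_zero hz 0)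
    have hs' : φ s = z 0 := hs
    have e : z = fun n => φ (shiftBy n s) :=
      orbit_ext h.ne_zero hz.1 (hφo s).1 0 (by simp only [shiftBy_zero, hs'])
    exact ⟨s, congrFun e⟩
  -- Points of `K p₀` closer than `η` have the same symbol at `0`.
  obtain ⟨η, hη0, hη⟩ : ∃ η > 0, ∀ s s' : Sigma2, ‖φ s - φ s'‖ < η → s 0 = s' 0 := by
    have hcl : IsClosed {x : Sigma2 × Sigma2 | x.1 0 ≠ x.2 0} := by
      have hc : Continuous fun x : Sigma2 × Sigma2 => (x.1 0, x.2 0) := by fun_prop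
      exact (isClosed_discrete {y : Fin 2 × Fin 2 | y.1 ≠ y.2}).preimage hc
    obtain ⟨η, hη0, hη⟩ := hcl.isCompact.exists_forall_le' (f := fun x => ‖φ x.1 - φ x.2‖) (a := 0)
      (by fun_prop) (fun x hx => norm_pos_iff.2 (sub_ne_zero.2 fun e => hx (by rw [hφi _ _ e])))
    refine ⟨η, hη0, fun s s' hs => ?_⟩
    by_contra hne
    exact absurd (hη (s, s') hne) (not_le.2 hs)
  -- The symbols in the finite window `J` determine the point up to `ε / 2`.
  obtain ⟨J, hJ⟩ : ∃ J : Finset ℤ, ∀ s s' : Sigma2, (∀ j ∈ J, s j = s' j) → ‖φ s - φ s'‖ < ε / 2 := by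
    have hcl : IsClosed {x : Sigma2 × Sigma2 | ε / 2 ≤ ‖φ x.1 - φ x.2‖} :=
      isClosed_le (by fun_prop) (by fun_prop)
    obtain ⟨J, hJ⟩ := hcl.isCompact.elim_finite_subcover
      (fun j : ℤ => {x : Sigma2 × Sigma2 | x.1 j ≠ x.2 j}) (fun j => by
        have hc : Continuous fun x : Sigma2 × Sigma2 => (x.1 j, x.2 j) := by fun_prop
        exact (isOpen_discrete {y : Fin 2 × Fin 2 | y.1 ≠ y.2}).preimage hc) (fun x hx => by
        by_contra hcon
        simp only [mem_iUnion, mem_ofPred_eq, not_exists, not_not] at hcon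
        have e : x.1 = x.2 := funext hcon
        simp only [mem_ofPred_eq, e, sub_self, norm_zero] at hx
        linarith)
    refine ⟨J, fun s s' hs => ?_⟩
    by_contra! hcon
    have := hJ (show (s, s') ∈ _ from hcon)
    simp only [mem_iUnion, mem_ofPred_eq] at this
    obtain ⟨j, hj, hne⟩ := this
    exact hne (hs j hj)
  have hδ : 0 < min (η / 2) (ε / 2) := by positivity
  filter_upwards [eventually_close_on_finset p₀ (insert 0 J) hδ] with p hp w hw
  -- For each `n` the orbit `w`, seen from time `n`, is approximated on the window by a bounded
  -- orbit of `p₀` with code `u n`. The shadowing orbit is coded by the diagonal sequence `n ↦ u n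
  -- 0`.
  choose x hx hxw using fun n : ℤ => hp _ (shift_mem_boundedOrbits hw n)
  choose u hu using fun n => hφs (x n) (hx n)
  refine ⟨_, hφo fun n => u n 0, fun n => ?_⟩
  have h0 : ∀ n, ‖w n - φ (u n)‖ < min (η / 2) (ε / 2) := fun n => by
    have := hxw n 0 (Finset.mem_insert_self _ _)
    rwa [hu n 0, shiftBy_zero, zero_add] at this
  have h1 : ‖φ (u n) - φ (shiftBy n fun n => u n 0)‖ < ε / 2 := by
    -- Both `shiftBy j (u n)` and `u (j + n)` code points within `η / 2` of `w (j + n)`, so they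
    -- share the symbol at `0`.
    refine hJ _ _ fun j hj => ?_
    have h2 : ‖w (j + n) - φ (shiftBy j (u n))‖ < η / 2 := by
      have := hxw n j (Finset.mem_insert_of_mem hj)
      rw [hu n j] at this
      exact this.trans_le (min_le_left _ _)
    have h3 := (h0 (j + n)).trans_le (min_le_left _ _)
    have h4 := hη (shiftBy j (u n)) (u (j + n)) (by
      have e : φ (shiftBy j (u n)) - φ (u (j + n))
        = (w (j + n) - φ (u (j + n))) - (w (j + n) - φ (shiftBy j (u n))) := by abel
      rw [e]
      refine (norm_sub_le _ _).trans_lt ?_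
      linarith)
    simpa [shiftBy] using h4
  have h2 := (h0 n).trans_le (min_le_right _ _)
  calc _ = ‖(w n - φ (u n)) + (φ (u n) - φ (shiftBy n fun n => u n 0))‖ := by congr 1; abel
    _ ≤ _ := norm_add_le _ _
    _ ≤ ε := by linarith

/-- A hyperbolic parameter close to a horseshoe is a horseshoe. -/
theorem mem_horseshoeLocus_of_close {p p' : ℂ × ℂ} {M r : ℝ} (h : OrbitHyperbolic p M)
    (h' : OrbitHyperbolic p' M) (hr : escapeRadius p ≤ r) (hr' : escapeRadius p' ≤ r)
    (hd : ‖p' - p‖ ≤ 1 / (16 * M ^ 2 * (1 + r))) (hp : p ∈ horseshoeLocus) :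
    p' ∈ horseshoeLocus := by
  obtain ⟨-, ⟨c⟩⟩ := mem_horseshoeLocus_iff.1 hp
  obtain ⟨φ, F, -⟩ := (c.isShiftFamily (T := Unit)).exists_extension (γ' := fun _ => p')
    continuous_const (fun _ => h) (fun _ => h') (fun _ => hr) (fun _ => hr') (fun _ => hd)
  obtain ⟨c', -⟩ := F.exists_shiftConjugacy ()
  exact mem_horseshoeLocus_iff.2 ⟨⟨M, h'⟩, ⟨c'⟩⟩

theorem eventually_close (p : ℂ × ℂ) {M r : ℝ} (hM : 1 ≤ M) (hr : 0 ≤ r) :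
    ∀ᶠ p' in nhds p, ‖p' - p‖ ≤ 1 / (16 * M ^ 2 * (1 + r)) := by
  have : 0 < 1 / (16 * M ^ 2 * (1 + r)) := by positivity
  filter_upwards [Metric.closedBall_mem_nhds p this] with p' hp'
  rwa [← dist_eq_norm]

/-- Shadowing transfers hyperbolicity to nearby parameters with constant `2 * M`, after which the
conjugacy extends. The constant is uniform near `p`, as needed for compactness along paths. -/
theorem eventually_horseshoe {p : ℂ × ℂ} (hp : p ∈ horseshoeLocus) :
    ∃ M, ∀ᶠ p' in nhds p, OrbitHyperbolic p' M ∧ p' ∈ horseshoeLocus := by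
  obtain ⟨⟨M, hM⟩, ⟨c⟩⟩ := mem_horseshoeLocus_iff.1 hp
  have hM1 := hM.one_le
  have hR := one_le_escapeRadius p
  have hpos : 0 < 1 / (8 * M) := by positivity
  have hne : ∀ᶠ p' : ℂ × ℂ in nhds p, p'.1 ≠ 0 :=
    continuous_fst.continuousAt.eventually_ne hM.ne_zero
  refine ⟨2 * M, ?_⟩
  filter_upwards [hne, c.eventually_shadowed hpos, Metric.closedBall_mem_nhds p hpos,
    eventually_close p (M := 2 * M) (r := escapeRadius p + 1) (by linarith) (by linarith),
    continuous_escapeRadius.continuousAt.eventually_lt_const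
      (show escapeRadius p < escapeRadius p + 1 by linarith)] with p' h1 h2 h3 h4 h5
  have h' := hM.of_shadowing h1 (by rwa [← dist_eq_norm]) h2
  exact ⟨h', mem_horseshoeLocus_of_close (hM.mono (by linarith)) h' (by linarith) h5.le h4 hp⟩

theorem isOpen_horseshoeLocus : IsOpen horseshoeLocus :=
  isOpen_iff_mem_nhds.2 fun _ hp =>
    (eventually_horseshoe hp).choose_spec.mono fun _ h => h.2

/-! ### Hyperbolicity on the Hubbard–Oberste-Vorth region -/

theorem norm_add_mul_le_of_dominant {a d e₁ e₂ : ℂ} {w₀ w₁ w₂ τ B : ℝ} (hw₁ : 0 ≤ w₁)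
    (hw₂ : 0 ≤ w₂) (h₁ : ‖e₁‖ ≤ B) (h₂ : ‖e₂‖ ≤ B) (h : w₁ + ‖a‖ * w₂ + τ ≤ ‖d‖ * w₀) :
    ‖w₁ * e₁ + a * (w₂ * e₂)‖ ≤ (‖d‖ * w₀ - τ) * B := by
  have hB : 0 ≤ B := (norm_nonneg _).trans h₁
  calc _ ≤ ‖w₁ * e₁‖ + ‖a * (w₂ * e₂)‖ := norm_add_le _ _
    _ = w₁ * ‖e₁‖ + ‖a‖ * (w₂ * ‖e₂‖) := by
        simp only [norm_mul, Complex.norm_real, Real.norm_eq_abs, abs_of_nonneg hw₁,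
          abs_of_nonneg hw₂]
    _ ≤ w₁ * B + ‖a‖ * (w₂ * B) := by gcongr
    _ = (w₁ + ‖a‖ * w₂) * B := by ring
    _ ≤ _ := mul_le_mul_of_nonneg_right (by linarith) hB

/-- Hyperbolicity from diagonal dominance in a weighted sup norm. -/
theorem isDichotomy_of_dominant {p : ℂ × ℂ} {z : ℤ → ℂ × ℂ} {w : ℤ → ℝ} {τ W D : ℝ} (hτ : 0 < τ)
    (hw : ∀ n, τ ≤ w n) (hW : ∀ n, w n ≤ W) (hD : ∀ n, ‖2 * (z n).1‖ ≤ D)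
    (h : ∀ n, w (n + 1) + ‖p.1‖ * w (n - 1) + τ ≤ ‖2 * (z n).1‖ * w n) :
    IsDichotomy (fun n => henonDeriv p (z n)) (W * (1 + ‖p.1‖) / τ + 1) := by
  have hw0 : ∀ n, 0 < w n := fun n => hτ.trans_le (hw n)
  have hwC : ∀ n, (w n : ℂ) ≠ 0 := fun n => by exact_mod_cast (hw0 n).ne'
  have hdw : ∀ n, τ ≤ ‖2 * (z n).1‖ * w n := fun n => by
    have := hw0 (n + 1)
    have := mul_nonneg (norm_nonneg p.1) (hw0 (n - 1)).le
    linarith [h n]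
  have hd0 : ∀ n, 0 < ‖2 * (z n).1‖ := fun n =>
    pos_of_mul_pos_left (hτ.trans_le (hdw n)) (hw0 n).le
  have hdC : ∀ n, 2 * (z n).1 ≠ 0 := fun n => norm_pos_iff.1 (hd0 n)
  have hW0 : 0 < W := (hw0 0).trans_le (hW 0)
  have hDW : ∀ n, ‖2 * (z n).1‖ * w n ≤ D * W := fun n =>
    mul_le_mul (hD n) (hW n) (hw0 n).le ((norm_nonneg _).trans (hD n))
  have hDW0 : 0 < D * W := hτ.trans_le ((hdw 0).trans (hDW 0))
  set k := 1 - τ / (D * W) with hk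
  have hk0 : 0 ≤ k := sub_nonneg.2 ((div_le_one hDW0).2 ((hdw 0).trans (hDW 0)))
  have hk1 : k < 1 := by rw [hk]; linarith [div_pos hτ hDW0]
  have hcontr : ∀ n (e₁ e₂ : ℂ) B, ‖e₁‖ ≤ B → ‖e₂‖ ≤ B →
      ‖(w (n + 1) * e₁ + p.1 * (w (n - 1) * e₂)) / (2 * (z n).1 * w n)‖ ≤ k * B := by
    intro n e₁ e₂ B h₁ h₂
    have hB : 0 ≤ B := (norm_nonneg _).trans h₁
    have hpos := hτ.trans_le (hdw n)
    rw [norm_div, norm_mul (2 * (z n).1), Complex.norm_real, Real.norm_eq_abs, abs_of_pos (hw0 n),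
      div_le_iff₀ hpos]
    refine (norm_add_mul_le_of_dominant (hw0 _).le (hw0 _).le h₁ h₂ (h n)).trans ?_
    have h3 : τ / (D * W) * (‖2 * (z n).1‖ * w n) ≤ τ := by
      rw [div_mul_eq_mul_div, div_le_iff₀ hDW0]
      exact mul_le_mul_of_nonneg_left (hDW n) hτ.le
    have h4 := mul_le_mul_of_nonneg_right h3 hB
    rw [hk]
    linarith
  refine ⟨fun f B hf => ?_, fun v hv hv' => ?_⟩
  · have hB : 0 ≤ B := (norm_nonneg _).trans (hf 0)
    -- Eliminating the second coordinate leaves the scalar recurrence `u (n + 1) + a * u (n - 1) = 2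
    -- * x n * u n + g n`. With `u = w * U` it is solved for the dominant term `U n`, which gives a
    -- contraction.
    set g : ℤ → ℂ := fun n => (f n).1 - p.1 * (f (n - 1)).2 with hg
    set G := (1 + ‖p.1‖) * B with hG
    have hgG : ∀ n, ‖g n‖ ≤ G := fun n => by
      calc ‖g n‖ ≤ ‖(f n).1‖ + ‖p.1‖ * ‖(f (n - 1)).2‖ := by
            rw [← norm_mul]; exact norm_sub_le _ _
        _ ≤ B + ‖p.1‖ * B := by
            gcongr
            exacts [(norm_fst_le _).trans (hf _), (norm_snd_le _).trans (hf _)]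
        _ = G := by rw [hG]; ring
    have hG0 : 0 ≤ G := by positivity
    obtain ⟨U, hU, hTU⟩ := exists_fixed_sequence (fun (U : ℤ → ℂ) n =>
      (w (n + 1) * U (n + 1) + p.1 * (w (n - 1) * U (n - 1))) / (2 * (z n).1 * w n)
        - g n / (2 * (z n).1 * w n)) (ε := G / τ) (by positivity) hk0 hk1
      (fun U hU n => by
        have hpos := hτ.trans_le (hdw n)
        rw [← sub_div, norm_div, norm_mul (2 * (z n).1), Complex.norm_real, Real.norm_eq_abs,
          abs_of_pos (hw0 n), div_le_iff₀ hpos]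
        refine (norm_sub_le _ _).trans ((add_le_add (norm_add_mul_le_of_dominant (hw0 _).le
          (hw0 _).le (hU _) (hU _) (h n)) (hgG n)).trans (le_of_eq ?_))
        field_simp
        ring)
      (fun U U' _ _ B hB n => by
        rw [sub_sub_sub_cancel_right, ← sub_div]
        have e : w (n + 1) * U (n + 1) + p.1 * (w (n - 1) * U (n - 1))
            - (w (n + 1) * U' (n + 1) + p.1 * (w (n - 1) * U' (n - 1)))
            = w (n + 1) * (U (n + 1) - U' (n + 1)) + p.1 * (w (n - 1) * (U (n - 1) - U' (n - 1))) := by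
          ring
        rw [e]
        exact hcontr n _ _ B (hB _) (hB _))
    have hu : ∀ n, ‖w n * U n‖ ≤ W * (G / τ) := fun n => by
      rw [norm_mul, Complex.norm_real, Real.norm_eq_abs, abs_of_pos (hw0 n)]
      exact mul_le_mul (hW n) (hU n) (norm_nonneg _) hW0.le
    have hbound : W * (G / τ) + B = (W * (1 + ‖p.1‖) / τ + 1) * B := by rw [hG]; ring
    refine ⟨fun n => (w n * U n, w (n - 1) * U (n - 1) + (f (n - 1)).2), fun n => ?_, fun n => ?_⟩
    · have e := congrFun hTU n
      rw [← sub_div, div_eq_iff (mul_ne_zero (hdC n) (hwC n)), hg] at e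
      rw [henonDeriv_apply]
      refine Prod.ext ?_ ?_
      · simp only [Prod.fst_add]
        linear_combination e
      · simp
    · rw [← hbound]
      refine max_le ((hu n).trans (by linarith)) ((norm_add_le _ _).trans ?_)
      exact add_le_add (hu _) ((norm_snd_le _).trans (hf _))
  · obtain ⟨B, hB⟩ := hv
    have h2 : ∀ n, (v n).2 = (v (n - 1)).1 := fun n => by
      have := hv' (n - 1)
      rw [sub_add_cancel, henonDeriv_apply] at this
      rw [this]
    have h1 : ∀ n, (v (n + 1)).1 + p.1 * (v (n - 1)).1 = 2 * (z n).1 * (v n).1 := fun n => by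
      rw [hv', henonDeriv_apply, h2]
      ring
    have h0 : ∀ n, (v n).1 / w n = 0 := by
      refine eq_zero_of_contracting hk0 hk1 ⟨B / τ, fun n => ?_⟩ fun B hB n => ?_
      · rw [norm_div, Complex.norm_real, Real.norm_eq_abs, abs_of_pos (hw0 n)]
        exact div_le_div₀ ((norm_nonneg _).trans (hB n)) ((norm_fst_le _).trans (hB n)) hτ (hw n)
      · have := hcontr n _ _ B (hB (n + 1)) (hB (n - 1))
        rw [mul_div_cancel₀ _ (hwC _), mul_div_cancel₀ _ (hwC _), h1, mul_div_mul_left _ _ (hdC n)]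
          at this
        exact this
    have h3 : ∀ n, (v n).1 = 0 := fun n => by simpa [hwC n] using h0 n
    exact fun n => Prod.ext (h3 n) (by rw [h2, h3]; rfl)

/-- The radius in the scale `1 + |a|`. -/
theorem exists_scaled_radius {κ : ℝ} (hκ : 0 ≤ κ) : ∃ ρ : ℝ, 1 ≤ ρ ∧ ρ ^ 2 - ρ = κ := by
  have h1 : (1 : ℝ) ≤ √(1 + 4 * κ) := Real.one_le_sqrt.2 (by linarith)
  refine ⟨(1 + √(1 + 4 * κ)) / 2, by linarith, ?_⟩
  have := Real.sq_sqrt (show 0 ≤ 1 + 4 * κ by linarith)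
  nlinarith

/-- The radius `(1 + |a|) * ρ` satisfies the quadratic inequality of the a priori bound with
equality. -/
theorem norm_le_scaled_radius {p : ℂ × ℂ} {ρ : ℝ} (hρ : 1 ≤ ρ)
    (hc : ‖p.2‖ = (1 + ‖p.1‖) ^ 2 * (ρ ^ 2 - ρ)) {z : ℤ → ℂ × ℂ} (hz : z ∈ boundedOrbits p) (n : ℤ) :
    ‖z n‖ ≤ (1 + ‖p.1‖) * ρ :=
  norm_le_of_mem_boundedOrbits hz (by positivity) (by rw [hc]; nlinarith) n

/-- With `m ^ 2` replaced by its lower bound, the right side minus the left is `(ρ² - ξ²) (ρ - ξ) (ρ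
+ ξ - 2) + 2 (ξ - 1) τ`. Both terms are nonnegative for `ξ ≥ 1`; for `ξ < 1` the product is at least
`3 τ`. -/
theorem weight_inequality {ρ τ ξ m : ℝ} (hτ : 0 < τ) (hρ : 2 + τ ≤ ρ) (hξ : 0 ≤ ξ)
    (hξρ : ξ ≤ ρ) (hm : |ρ ^ 2 - ρ - ξ ^ 2| ≤ m) :
    ρ ^ 2 + τ - m ^ 2 + τ ≤ 2 * ξ * (ρ ^ 2 + τ - ξ ^ 2) := by
  have h1 : (ρ ^ 2 - ρ - ξ ^ 2) ^ 2 ≤ m ^ 2 := by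
    rw [← sq_abs]
    exact pow_le_pow_left₀ (abs_nonneg _) hm 2
  have h2 : τ ≤ (ρ ^ 2 - ξ ^ 2) * ((ρ - ξ) * (ρ + ξ - 2)) + (2 * ξ - 1) * τ := by
    rcases le_or_gt 1 ξ with h | h
    · have h3 : 0 ≤ (ρ ^ 2 - ξ ^ 2) * ((ρ - ξ) * (ρ + ξ - 2)) := by
        refine mul_nonneg ?_ (mul_nonneg (by linarith) (by linarith))
        nlinarith
      nlinarith
    · have h3 : 3 ≤ ρ ^ 2 - ξ ^ 2 := by nlinarith
      have h4 : 1 * τ ≤ (ρ - ξ) * (ρ + ξ - 2) :=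
        mul_le_mul (by linarith) (by linarith) hτ.le (by linarith)
      have h5 : 3 * (1 * τ) ≤ (ρ ^ 2 - ξ ^ 2) * ((ρ - ξ) * (ρ + ξ - 2)) :=
        mul_le_mul h3 h4 (by linarith) (by linarith)
      nlinarith
  nlinarith

/-- The weight `ρ² + τ - (|x| / A)²` is large where `x`, and with it the expansion `2 |x|`, is
small. The relation between `x²`, `c` and the neighbouring points then forces large neighbours,
whose weights are small. So diagonal dominance survives at points where it fails without weights. -/
theorem exists_orbitHyperbolic_of_large {τ : ℝ} (hτ : 0 < τ) (hτ1 : τ ≤ 1) {r : ℝ} (hr : 1 ≤ r) :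
    ∃ M, ∀ p : ℂ × ℂ, p.1 ≠ 0 → (2 + τ) * (1 + τ) * (1 + ‖p.1‖) ^ 2 ≤ ‖p.2‖ → escapeRadius p ≤ r →
      OrbitHyperbolic p M := by
  have hM : 0 ≤ ((1 + r) ^ 2 + 1) * (1 + r) / τ := by positivity
  refine ⟨((1 + r) ^ 2 + 1) * (1 + r) / τ + 1, fun p hp hpc hpr => ⟨hp, by linarith, fun z hz => ?_⟩⟩
  set A := 1 + ‖p.1‖ with hA
  have hA1 : 1 ≤ A := by rw [hA]; linarith [norm_nonneg p.1]
  obtain ⟨ρ, hρ1, hρ⟩ := exists_scaled_radius (κ := ‖p.2‖ / A ^ 2) (by positivity)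
  have hc : ‖p.2‖ = A ^ 2 * (ρ ^ 2 - ρ) := by rw [hρ]; field_simp
  -- At `ρ = 2 + τ` the value of `ρ² - ρ` is the constant `(2 + τ) * (1 + τ)` of the hypothesis.
  have hρτ : 2 + τ ≤ ρ := by
    rw [hc, mul_comm] at hpc
    have := le_of_mul_le_mul_left hpc (by positivity)
    by_contra! hlt
    nlinarith
  have hp1 : ‖p.1‖ ≤ r := by unfold escapeRadius at hpr; linarith [norm_nonneg p.2]
  have hp2 : ‖p.2‖ ≤ r := by unfold escapeRadius at hpr; linarith [norm_nonneg p.1]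
  have hρr : ρ ≤ 1 + r := by
    have h1 : ρ ^ 2 - ρ ≤ r := by rw [hρ]; exact (div_le_self (norm_nonneg _) (by nlinarith)).trans hp2
    by_contra! hlt
    nlinarith
  have hzρ := norm_le_scaled_radius hρ1 hc hz
  have hξρ : ∀ n, ‖(z n).1‖ / A ≤ ρ := fun n => by
    rw [div_le_iff₀ (by positivity), mul_comm]
    exact (norm_fst_le _).trans (hzρ n)
  have hξ0 : ∀ n, 0 ≤ ‖(z n).1‖ / A := fun n => by positivity
  refine (isDichotomy_of_dominant (w := fun n => ρ ^ 2 + τ - (‖(z n).1‖ / A) ^ 2) (W := ρ ^ 2 + τ)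
    (D := 2 * (A * ρ)) hτ (fun n => ?_) (fun n => ?_) (fun n => ?_) (fun n => ?_)).mono ?_
  · nlinarith [hξρ n, hξ0 n]
  · nlinarith [sq_nonneg (‖(z n).1‖ / A)]
  · rw [norm_mul]
    have := (norm_fst_le (z n)).trans (hzρ n)
    norm_num
    linarith
  · set ξ := ‖(z n).1‖ / A with hξ
    set ξ₁ := ‖(z (n + 1)).1‖ / A with hξ₁
    set ξ₂ := ‖(z (n - 1)).1‖ / A with hξ₂
    have e0 : ‖(z n).1‖ = A * ξ := by rw [hξ]; field_simp
    have e1 : ‖(z (n + 1)).1‖ = A * ξ₁ := by rw [hξ₁]; field_simp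
    have e2 : ‖(z (n - 1)).1‖ = A * ξ₂ := by rw [hξ₂]; field_simp
    set m := (ξ₁ + ‖p.1‖ * ξ₂) / A with hm
    have em : ξ₁ + ‖p.1‖ * ξ₂ = A * m := by rw [hm]; field_simp
    have h1 : |ρ ^ 2 - ρ - ξ ^ 2| ≤ m := by
      have h2 : |‖p.2‖ - ‖(z n).1 ^ 2‖| ≤ ‖(z (n + 1)).1‖ + ‖p.1‖ * ‖(z (n - 1)).1‖ := by
        have hs : (z n).2 = (z (n - 1)).1 := by rw [← orbit_snd hz, sub_add_cancel]
        have hx := orbit_fst hz n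
        rw [hs] at hx
        rw [← norm_neg ((z n).1 ^ 2)]
        refine (abs_norm_sub_norm_le _ _).trans ?_
        rw [hx, ← norm_mul]
        refine le_trans (le_of_eq ?_) (norm_add_le _ _)
        congr 1
        ring
      rw [e1, e2, norm_pow, e0, hc] at h2
      have h3 : A ^ 2 * |ρ ^ 2 - ρ - ξ ^ 2| ≤ A ^ 2 * m := by
        calc A ^ 2 * |ρ ^ 2 - ρ - ξ ^ 2| = |A ^ 2 * (ρ ^ 2 - ρ) - (A * ξ) ^ 2| := by
              rw [← abs_of_nonneg (show 0 ≤ A ^ 2 by positivity), ← abs_mul,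
                abs_of_nonneg (show 0 ≤ A ^ 2 by positivity)]
              congr 1; ring
          _ ≤ _ := h2
          _ = A * (ξ₁ + ‖p.1‖ * ξ₂) := by ring
          _ = _ := by rw [em]; ring
      exact le_of_mul_le_mul_left h3 (by positivity)
    have h4 := weight_inequality hτ hρτ (hξ0 n) (hξρ n) h1
    -- Convexity of the square: `m` is the mean of `ξ₁` and `ξ₂` with weights `1 / A` and `|a| / A`.
    have h5 : A * m ^ 2 ≤ ξ₁ ^ 2 + ‖p.1‖ * ξ₂ ^ 2 := by
      have h6 : A * (A * m ^ 2) ≤ A * (ξ₁ ^ 2 + ‖p.1‖ * ξ₂ ^ 2) := by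
        calc A * (A * m ^ 2) = (ξ₁ + ‖p.1‖ * ξ₂) ^ 2 := by rw [em]; ring
          _ ≤ _ := by
            rw [hA]
            nlinarith [mul_nonneg (norm_nonneg p.1) (sq_nonneg (ξ₁ - ξ₂))]
      exact le_of_mul_le_mul_left h6 (by positivity)
    have h7 := mul_le_mul_of_nonneg_left h4 (show 0 ≤ A by positivity)
    have e3 : ‖2 * (z n).1‖ = 2 * (A * ξ) := by rw [norm_mul, e0]; norm_num
    rw [e3]
    have h8 : ‖p.1‖ = A - 1 := by rw [hA]; ring
    have h9 : τ ≤ A * τ := by nlinarith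
    rw [h8] at h5 ⊢
    linarith
  · have h1 : ρ ^ 2 + τ ≤ (1 + r) ^ 2 + 1 := by nlinarith
    have h2 : A ≤ 1 + r := by rw [hA]; linarith
    gcongr

theorem eventually_orbitHyperbolic_of_mem_HOV {p : ℂ × ℂ} (hp : p ∈ HOV) :
    ∃ M, ∀ᶠ p' in nhds p, OrbitHyperbolic p' M := by
  obtain ⟨hpc, hp0⟩ := hp
  have hA : (0 : ℝ) < (1 + ‖p.1‖) ^ 2 := by positivity
  set κ := ‖p.2‖ / (1 + ‖p.1‖) ^ 2 with hκ
  have hκ2 : 2 < κ := by rw [hκ, lt_div_iff₀ hA, add_comm]; exact hpc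
  -- As `τ ≤ 1`, `(2 + τ) * (1 + τ) ≤ 2 + 4 * τ`, which is below `κ` for this choice.
  set τ := min 1 ((κ - 2) / 8) with hτ
  have hτ0 : 0 < τ := lt_min one_pos (by linarith)
  have hτ1 : τ ≤ 1 := min_le_left _ _
  have hτ2 : τ ≤ (κ - 2) / 8 := min_le_right _ _
  have hR := one_le_escapeRadius p
  obtain ⟨M, hM⟩ := exists_orbitHyperbolic_of_large hτ0 hτ1 (r := escapeRadius p + 1) (by linarith)
  have hlt : (2 + τ) * (1 + τ) * (1 + ‖p.1‖) ^ 2 - ‖p.2‖ < 0 := by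
    have h1 : (2 + τ) * (1 + τ) < κ := by nlinarith
    rw [hκ, lt_div_iff₀ hA] at h1
    linarith
  have hcont : Continuous fun p : ℂ × ℂ => (2 + τ) * (1 + τ) * (1 + ‖p.1‖) ^ 2 - ‖p.2‖ := by fun_prop
  refine ⟨M, ?_⟩
  filter_upwards [hcont.continuousAt.eventually_lt_const hlt,
    continuous_fst.continuousAt.eventually_ne hp0,
    continuous_escapeRadius.continuousAt.eventually_lt_const
      (show escapeRadius p < escapeRadius p + 1 by linarith)] with p' h1 h2 h3
  exact hM p' h2 (by linarith) h3.le

/-- In exponential coordinates the region is the image of a convex half-space. -/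
theorem isPreconnected_HOV : IsPreconnected HOV := by
  have hconv : Convex ℝ {x : ℂ × ℂ | 0 < x.2.re} := by
    have : {x : ℂ × ℂ | 0 < x.2.re} = (Complex.reLm ∘ₗ LinearMap.snd ℝ ℂ ℂ) ⁻¹' Ioi 0 := rfl
    rw [this]
    exact (convex_Ioi 0).linear_preimage _
  have hcont : Continuous fun x : ℂ × ℂ =>
      ((Complex.exp x.1, ((2 * (‖Complex.exp x.1‖ + 1) ^ 2 : ℝ) : ℂ) * Complex.exp x.2) : ℂ × ℂ) := by
    fun_prop
  convert! hconv.isPreconnected.image _ hcont.continuousOn using 1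
  ext ⟨a, c⟩
  constructor
  · rintro ⟨h1, h2⟩
    have h2' : a ≠ 0 := h2
    have hb : (0 : ℝ) < 2 * (‖a‖ + 1) ^ 2 := by positivity
    have hbC : ((2 * (‖a‖ + 1) ^ 2 : ℝ) : ℂ) ≠ 0 := by exact_mod_cast hb.ne'
    have hc : c ≠ 0 := fun h => by
      have h1' : 2 * (‖a‖ + 1) ^ 2 < ‖c‖ := h1
      rw [h, norm_zero] at h1'; linarith
    have hq : c / ((2 * (‖a‖ + 1) ^ 2 : ℝ) : ℂ) ≠ 0 := div_ne_zero hc hbC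
    refine ⟨(Complex.log a, Complex.log (c / ((2 * (‖a‖ + 1) ^ 2 : ℝ) : ℂ))), ?_, ?_⟩
    · change 0 < (Complex.log _).re
      rw [Complex.log_re, norm_div, Complex.norm_real, Real.norm_eq_abs, abs_of_pos hb]
      exact Real.log_pos ((one_lt_div hb).2 h1)
    · simp only [Complex.exp_log h2', Complex.exp_log hq, mul_div_cancel₀ _ hbC]
  · rintro ⟨⟨u, w⟩, hw, hx⟩
    rw [← hx]
    refine ⟨?_, Complex.exp_ne_zero _⟩
    have hb : (0 : ℝ) < 2 * (‖Complex.exp u‖ + 1) ^ 2 := by positivity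
    change 2 * (‖Complex.exp u‖ + 1) ^ 2
      < ‖((2 * (‖Complex.exp u‖ + 1) ^ 2 : ℝ) : ℂ) * Complex.exp w‖
    rw [norm_mul, Complex.norm_real, Real.norm_eq_abs, abs_of_pos hb]
    refine lt_mul_of_one_lt_right hb ?_
    rw [Complex.norm_exp]
    exact Real.one_lt_exp_iff.2 hw

/-- The region consists of horseshoes as soon as it contains one. -/
theorem HOV_subset_horseshoeLocus (h : (HOV ∩ horseshoeLocus).Nonempty) : HOV ⊆ horseshoeLocus := by
  refine isPreconnected_HOV.subset_of_closure_inter_subset isOpen_horseshoeLocus h ?_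
  rintro p ⟨hcl, hp⟩
  obtain ⟨M, hM⟩ := eventually_orbitHyperbolic_of_mem_HOV hp
  have hR := one_le_escapeRadius p
  have hev := hM.and ((eventually_close p (M := M) (r := escapeRadius p + 1) hM.self_of_nhds.one_le
    (by linarith)).and (continuous_escapeRadius.continuousAt.eventually_lt_const
      (show escapeRadius p < escapeRadius p + 1 by linarith)))
  -- A limit `p` of horseshoes in the region is hyperbolic with the constant `M` of its neighbours,
  -- so the coding of a nearby `p'` extends to `p`.
  obtain ⟨p', hp', h1, h2, h3⟩ := ((mem_closure_iff_frequently.1 hcl).and_eventually hev).exists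
  exact mem_horseshoeLocus_of_close h1 hM.self_of_nhds h3.le (by linarith)
    (by rwa [norm_sub_rev]) hp'

/-! ### The Devaney–Nitecki region -/

theorem toComplex_mem_HOV {q : ℝ × ℝ} (hq : q ∈ DN) : toComplex q ∈ HOV := by
  obtain ⟨h1, h2⟩ := hq
  refine ⟨?_, by simpa [toComplex] using h2⟩
  -- Thus `(5 + 2√5) / 4 ≥ 9 / 4 > 2`.
  have h5 : (2 : ℝ) ≤ √5 := Real.le_sqrt_of_sq_le (by norm_num)
  simp only [toComplex, Complex.norm_real, Real.norm_eq_abs]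
  have h3 : 0 < (|q.1| + 1) ^ 2 := by positivity
  have h4 := neg_abs_le q.2
  nlinarith

/-- In the Devaney–Nitecki region all bounded orbits are real. -/
theorem im_eq_zero_of_mem_DN {q : ℝ × ℝ} (hq : q ∈ DN) {z : ℤ → ℂ × ℂ}
    (hz : z ∈ boundedOrbits (toComplex q)) (n : ℤ) : (z n).1.im = 0 := by
  obtain ⟨hc, -⟩ := hq
  set A := 1 + |q.1| with hA
  have hA1 : 1 ≤ A := by rw [hA]; linarith [abs_nonneg q.1]
  have hs0 : 0 ≤ √(5 : ℝ) := Real.sqrt_nonneg 5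
  have hs2 : √(5 : ℝ) ^ 2 = 5 := Real.sq_sqrt (by norm_num)
  rw [add_comm |q.1|, ← hA] at hc
  have hcneg : 0 < -q.2 := by
    have : 0 ≤ (5 + 2 * √5) * A ^ 2 / 4 := by positivity
    linarith
  have hn1 : ‖(toComplex q).1‖ = |q.1| := by simp [toComplex]
  have hn2 : ‖(toComplex q).2‖ = -q.2 := by
    simp only [toComplex, Complex.norm_real, Real.norm_eq_abs]
    exact abs_of_neg (by linarith)
  obtain ⟨ρ, hρ1, hρ⟩ := exists_scaled_radius (κ := -q.2 / A ^ 2) (by positivity)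
  have hcρ : -q.2 = A ^ 2 * (ρ ^ 2 - ρ) := by rw [hρ]; field_simp
  -- At `ρ = 1 + √5 / 2` the quantity `ρ² - ρ` is the constant `(5 + 2√5) / 4`, and `ρ² - 2ρ` is `1
  -- / 4`. This is the threshold beyond which `|Re x| > A / 2` on all bounded orbits.
  have hρ5 : 1 + √5 / 2 < ρ := by
    have h1 : (5 + 2 * √5) / 4 < ρ ^ 2 - ρ := by
      rw [hρ, lt_div_iff₀ (by positivity)]
      linarith
    by_contra! hle
    nlinarith
  have hzρ : ∀ n, ‖z n‖ ≤ A * ρ := fun n => by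
    have := norm_le_scaled_radius hρ1 (by rw [hn1, hn2]; exact hcρ) hz n
    rwa [hn1] at this
  set β := ρ ^ 2 - 2 * ρ with hβ
  have hβ4 : 1 / 4 < β := by rw [hβ]; nlinarith
  have hre : ∀ n, A * √β ≤ |(z n).1.re| := by
    intro n
    have h1 := congrArg Complex.re (orbit_fst hz n)
    have e1 : ((z n).1 ^ 2).re = (z n).1.re ^ 2 - (z n).1.im ^ 2 := by
      rw [sq, Complex.mul_re]; ring
    have e2 : ((z (n + 1)).1 + (toComplex q).1 * (z n).2 - (toComplex q).2).re
        = (z (n + 1)).1.re + q.1 * (z n).2.re - q.2 := by simp [toComplex]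
    rw [e1, e2] at h1
    have h2 : |(z (n + 1)).1.re| ≤ A * ρ :=
      (Complex.abs_re_le_norm _).trans ((norm_fst_le _).trans (hzρ _))
    have h3 : |q.1 * (z n).2.re| ≤ |q.1| * (A * ρ) := by
      rw [abs_mul]
      exact mul_le_mul_of_nonneg_left
        ((Complex.abs_re_le_norm _).trans ((norm_snd_le _).trans (hzρ _))) (abs_nonneg _)
    have h4 : A ^ 2 * β ≤ (z n).1.re ^ 2 := by
      have h5 := neg_abs_le (z (n + 1)).1.re
      have h6 := neg_abs_le (q.1 * (z n).2.re)
      have h7 : A * ρ + |q.1| * (A * ρ) = A ^ 2 * ρ := by rw [hA]; ring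
      have h8 : A ^ 2 * β = -q.2 - A ^ 2 * ρ := by rw [hcρ, hβ]; ring
      have h9 := sq_nonneg (z n).1.im
      linarith
    refine abs_le_of_sq_le_sq' ?_ (abs_nonneg _) |>.2
    rw [mul_pow, Real.sq_sqrt (by linarith), sq_abs]
    exact h4
  have hsβ : 1 / 2 < √β := Real.lt_sqrt_of_sq_lt (by norm_num; linarith)
  have hk1 : 1 / (2 * √β) < 1 := by
    rw [div_lt_one (by linarith)]; linarith
  -- Imaginary parts satisfy `2 Re(x n) Im(x n) = Im(x (n + 1)) + a Im(x (n - 1))`, so any uniform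
  -- bound on them improves by the factor `1 / (2√β)`.
  refine eq_zero_of_contracting (v := fun n => (z n).1.im) (k := 1 / (2 * √β)) (by positivity) hk1
    ⟨A * ρ, fun n => (Complex.abs_im_le_norm _).trans ((norm_fst_le _).trans (hzρ n))⟩
    (fun B hB n => ?_) n
  have h1 := congrArg Complex.im (orbit_fst hz n)
  have hs : (z n).2 = (z (n - 1)).1 := by rw [← orbit_snd hz, sub_add_cancel]
  have e1 : ((z n).1 ^ 2).im = 2 * (z n).1.re * (z n).1.im := by
    rw [sq, Complex.mul_im]; ring
  have e2 : ((z (n + 1)).1 + (toComplex q).1 * (z n).2 - (toComplex q).2).im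
      = (z (n + 1)).1.im + q.1 * (z (n - 1)).1.im := by simp [toComplex, hs]
  rw [e1, e2] at h1
  simp only [Real.norm_eq_abs] at hB ⊢
  have h2 : 2 * |(z n).1.re| * |(z n).1.im| ≤ A * B := by
    calc 2 * |(z n).1.re| * |(z n).1.im| = |2 * (z n).1.re * (z n).1.im| := by
          rw [abs_mul, abs_mul]; norm_num
      _ = |(z (n + 1)).1.im + q.1 * (z (n - 1)).1.im| := by rw [h1]
      _ ≤ |(z (n + 1)).1.im| + |q.1| * |(z (n - 1)).1.im| := by
          rw [← abs_mul]; exact abs_add_le _ _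
      _ ≤ B + |q.1| * B := by gcongr <;> exact hB _
      _ = A * B := by rw [hA]; ring
  have h3 : 2 * (A * √β) * |(z n).1.im| ≤ A * B := le_trans (by gcongr; exact hre n) h2
  have h4 : A * (2 * √β * |(z n).1.im|) ≤ A * B := by linarith
  have h5 := le_of_mul_le_mul_left h4 (by positivity)
  rw [div_mul_eq_mul_div, one_mul, le_div_iff₀ (by linarith)]
  linarith

/-! ### Complex conjugation -/

theorem norm_conjC2 (z : ℂ × ℂ) : ‖conjC2 z‖ = ‖z‖ := by
  simp [conjC2, Prod.norm_def]

theorem conjC2_conjC2 (z : ℂ × ℂ) : conjC2 (conjC2 z) = z := by simp [conjC2]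

theorem conjC2_add (z w : ℂ × ℂ) : conjC2 (z + w) = conjC2 z + conjC2 w := by simp [conjC2]

theorem conjC2_henon (p z : ℂ × ℂ) : conjC2 (henon p z) = henon (conjC2 p) (conjC2 z) := by
  simp [conjC2, henon]

theorem conjC2_henonDeriv (p z v : ℂ × ℂ) :
    conjC2 (henonDeriv p z v) = henonDeriv (conjC2 p) (conjC2 z) (conjC2 v) := by
  have h2 : (starRingEnd ℂ) 2 = 2 := Complex.conj_ofNat 2
  simp [conjC2, henonDeriv_apply, h2]

theorem conjC2_fst_ne_zero {p : ℂ × ℂ} (hp : p.1 ≠ 0) : (conjC2 p).1 ≠ 0 := by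
  simpa [conjC2] using hp

theorem conjC2_mem_boundedOrbits {p : ℂ × ℂ} {z : ℤ → ℂ × ℂ} (hz : z ∈ boundedOrbits p) :
    (fun n => conjC2 (z n)) ∈ boundedOrbits (conjC2 p) := by
  obtain ⟨h, B, hB⟩ := hz
  exact ⟨fun n => by simp only [h, conjC2_henon], B, fun n => by rw [norm_conjC2]; exact hB n⟩

theorem conjC2_mem_K {p w : ℂ × ℂ} (hw : w ∈ K p) : conjC2 w ∈ K (conjC2 p) := by
  obtain ⟨hp, z, hz, rfl⟩ := mem_K_iff.1 hw
  exact apply_mem_K (conjC2_fst_ne_zero hp) (conjC2_mem_boundedOrbits hz) 0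

theorem IsDichotomy.conj {p : ℂ × ℂ} {z : ℤ → ℂ × ℂ} {M : ℝ}
    (h : IsDichotomy (fun n => henonDeriv p (z n)) M) :
    IsDichotomy (fun n => henonDeriv (conjC2 p) (conjC2 (z n))) M where
  exists_solution f B hf := by
    obtain ⟨v, hv, hb⟩ := h.exists_solution (fun n => conjC2 (f n)) B fun n => by
      rw [norm_conjC2]; exact hf n
    refine ⟨fun n => conjC2 (v n), fun n => ?_, fun n => by rw [norm_conjC2]; exact hb n⟩
    simp only [hv, conjC2_add, conjC2_conjC2, conjC2_henonDeriv]
  unique v hv hv' n := by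
    obtain ⟨B, hB⟩ := hv
    have := h.unique (fun n => conjC2 (v n)) ⟨B, fun n => by rw [norm_conjC2]; exact hB n⟩
      (fun n => by simp only [hv', conjC2_henonDeriv, conjC2_conjC2]) n
    rw [← norm_eq_zero, norm_conjC2, norm_eq_zero] at this
    exact this

theorem OrbitHyperbolic.conj {p : ℂ × ℂ} {M : ℝ} (h : OrbitHyperbolic p M) :
    OrbitHyperbolic (conjC2 p) M := by
  refine ⟨conjC2_fst_ne_zero h.ne_zero, h.one_le, fun z hz => ?_⟩
  have hz' := conjC2_mem_boundedOrbits hz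
  rw [conjC2_conjC2] at hz'
  simpa only [conjC2_conjC2] using (h.dichotomy _ hz').conj

namespace IsShiftFamily

variable {T : Type*} [TopologicalSpace T] {γ : T → ℂ × ℂ} {φ : T × Sigma2 → ℂ × ℂ}

theorem conj (F : IsShiftFamily γ φ) :
    IsShiftFamily (fun t => conjC2 (γ t)) fun x => conjC2 (φ x) where
  continuous := continuous_conjC2.comp F.continuous
  bijOn t := by
    refine ⟨fun s _ => conjC2_mem_K ((F.bijOn t).mapsTo (mem_univ s)), fun s _ s' _ hs => ?_,
      fun w hw => ?_⟩
    · have := congrArg conjC2 hs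
      simp only [conjC2_conjC2] at this
      exact (F.bijOn t).injOn (mem_univ _) (mem_univ _) this
    · have hw' := conjC2_mem_K hw
      rw [conjC2_conjC2] at hw'
      obtain ⟨s, hs, hsw⟩ := (F.bijOn t).surjOn hw'
      exact ⟨s, hs, by simp only at hsw ⊢; rw [hsw, conjC2_conjC2]⟩
  semiconj t s := by rw [F.semiconj, conjC2_henon]

theorem comp (F : IsShiftFamily γ φ) {T' : Type*} [TopologicalSpace T'] {f : T' → T}
    (hf : Continuous f) : IsShiftFamily (fun t => γ (f t)) fun x => φ (f x.1, x.2) where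
  continuous := F.continuous.comp ((hf.comp continuous_fst).prodMk continuous_snd)
  bijOn t := F.bijOn (f t)
  semiconj t := F.semiconj (f t)

end IsShiftFamily

theorem conjC2_mem_horseshoeLocus {p : ℂ × ℂ} (hp : p ∈ horseshoeLocus) :
    conjC2 p ∈ horseshoeLocus := by
  obtain ⟨⟨M, hM⟩, ⟨c⟩⟩ := mem_horseshoeLocus_iff.1 hp
  obtain ⟨c', -⟩ := (c.isShiftFamily (T := Unit)).conj.exists_shiftConjugacy ()
  exact mem_horseshoeLocus_iff.2 ⟨⟨M, hM.conj⟩, ⟨c'⟩⟩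

theorem conjC2_eq_of_mem_DN {q : ℝ × ℝ} (hq : q ∈ DN) {w : ℂ × ℂ} (hw : w ∈ K (toComplex q)) :
    conjC2 w = w := by
  obtain ⟨-, z, hz, rfl⟩ := mem_K_iff.1 hw
  have h2 : (z 0).2 = (z (-1)).1 := by rw [← orbit_snd hz, neg_add_cancel]
  refine Prod.ext (Complex.conj_eq_iff_im.2 (im_eq_zero_of_mem_DN hq hz 0))
    (Complex.conj_eq_iff_im.2 ?_)
  rw [h2]
  exact im_eq_zero_of_mem_DN hq hz (-1)

/-! ### The component of the horseshoe locus -/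

/-- `connectedComponentIn` of a point outside the set is empty, so the point `x` supplies a
horseshoe in `HOV`; then all of `HOV` lies in one component. -/
theorem horseshoeLocus₀_eq {x p : ℂ × ℂ} (hx : x ∈ horseshoeLocus₀) (hp : p ∈ HOV) :
    p ∈ horseshoeLocus ∧ horseshoeLocus₀ = connectedComponentIn horseshoeLocus p := by
  obtain ⟨q, hq, hxq⟩ := hx
  have hql : q ∈ horseshoeLocus := connectedComponentIn_nonempty_iff.1 ⟨x, hxq⟩
  have hsub := HOV_subset_horseshoeLocus ⟨q, hq, hql⟩
  refine ⟨hsub hp, Set.ext fun y => ⟨?_, fun hy => ⟨p, hp, hy⟩⟩⟩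
  rintro ⟨q', hq', hy⟩
  rwa [connectedComponentIn_eq (isPreconnected_HOV.subset_connectedComponentIn hp hsub hq')]

/-- Conjugation preserves the locus and fixes the real point `toComplex q`, so it maps the component
of that point into itself. -/
theorem conjC2_mem_horseshoeLocus₀ {q : ℝ × ℝ} (hq : q ∈ DN) {x : ℂ × ℂ}
    (hx : x ∈ horseshoeLocus₀) : conjC2 x ∈ horseshoeLocus₀ := by
  obtain ⟨hql, h0⟩ := horseshoeLocus₀_eq hx (toComplex_mem_HOV hq)
  rw [h0] at hx ⊢
  have hpre : IsPreconnected (conjC2 '' connectedComponentIn horseshoeLocus (toComplex q)) :=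
    isPreconnected_connectedComponentIn.image _ continuous_conjC2.continuousOn
  refine hpre.subset_connectedComponentIn
    ⟨toComplex q, mem_connectedComponentIn hql, conjC2_toComplex q⟩ ?_ ⟨x, hx, rfl⟩
  rintro _ ⟨y, hy, rfl⟩
  exact conjC2_mem_horseshoeLocus (connectedComponentIn_subset _ _ hy)

theorem horseshoeLocus₀_subset : horseshoeLocus₀ ⊆ horseshoeLocus := by
  rintro x ⟨q, -, hx⟩
  exact connectedComponentIn_subset _ _ hx

theorem exists_path {q : ℝ × ℝ} (hq : q ∈ DN) {x : ℂ × ℂ} (hx : x ∈ horseshoeLocus₀) :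
    ∃ α : Path (toComplex q) x, ∀ t, α t ∈ horseshoeLocus₀ := by
  obtain ⟨hql, h0⟩ := horseshoeLocus₀_eq hx (toComplex_mem_HOV hq)
  have hpc : IsPathConnected (connectedComponentIn horseshoeLocus (toComplex q)) :=
    (isOpen_horseshoeLocus.connectedComponentIn.isConnected_iff_isPathConnected).1
      (isConnected_connectedComponentIn_iff.2 hql)
  rw [h0] at hx ⊢
  have hj := hpc.joinedIn _ (mem_connectedComponentIn hql) _ hx
  exact ⟨hj.somePath, hj.somePath_mem⟩

/-! ### Continuation along paths -/

theorem exists_uniform_constants {p q : ℂ × ℂ} (γ : Path p q) (hγ : ∀ t, γ t ∈ horseshoeLocus) :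
    ∃ M r, ∀ t, OrbitHyperbolic (γ t) M ∧ escapeRadius (γ t) ≤ r := by
  have hc : IsCompact (range γ) := isCompact_range γ.continuous
  obtain ⟨r, hr⟩ := (hc.image continuous_escapeRadius).bddAbove
  obtain ⟨M, hM⟩ : ∃ M, ∀ x ∈ range γ, OrbitHyperbolic x M := by
    refine hc.induction_on (p := fun S => ∃ M, ∀ x ∈ S, OrbitHyperbolic x M) ⟨0, by simp⟩ ?_ ?_ ?_
    · rintro S S' hS ⟨M, hM⟩
      exact ⟨M, fun x hx => hM x (hS hx)⟩
    · rintro S S' ⟨M, hM⟩ ⟨M', hM'⟩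
      refine ⟨max M M', ?_⟩
      rintro x (hx | hx)
      · exact (hM x hx).mono (le_max_left _ _)
      · exact (hM' x hx).mono (le_max_right _ _)
    · rintro _ ⟨t, rfl⟩
      obtain ⟨M, hM⟩ := eventually_horseshoe (hγ t)
      exact ⟨_, mem_nhdsWithin_of_mem_nhds hM, M, fun x hx => hx.1⟩
  exact ⟨M, r, fun t => ⟨hM _ ⟨t, rfl⟩, hr ⟨_, ⟨t, rfl⟩, rfl⟩⟩⟩

theorem ShiftConjugacy.ext_symm {p : ℂ × ℂ} {h h' : ShiftConjugacy p}
    (e : ∀ s, (h.homeo.symm s : ℂ × ℂ) = h'.homeo.symm s) : h = h' := by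
  obtain ⟨f, hf⟩ := h
  obtain ⟨g, hg⟩ := h'
  have : f.symm = g.symm := Homeomorph.ext fun s => Subtype.ext (e s)
  have : f = g := by rw [← f.symm_symm, this, g.symm_symm]
  subst this
  rfl

theorem existsUnique_conjugacyFamily {p q : ℂ × ℂ} (γ : Path p q)
    (hγ : ∀ t, γ t ∈ horseshoeLocus) (h0 : ShiftConjugacy p) :
    ∃! h : ConjugacyFamily γ, h.StartsAt h0 := by
  obtain ⟨M, r, hMr⟩ := exists_uniform_constants γ hγ
  obtain ⟨h0', hh0⟩ : ∃ h0' : ShiftConjugacy (γ 0), ∀ s,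
      (h0'.homeo.symm s : ℂ × ℂ) = h0.homeo.symm s := by
    rw [γ.source]; exact ⟨h0, fun _ => rfl⟩
  obtain ⟨φ, F, hφ⟩ := IsShiftFamily.exists_continuation γ.continuous (fun t => (hMr t).1)
    (fun t => (hMr t).2) h0'
  choose c hc using F.exists_shiftConjugacy
  refine ⟨⟨c, ?_⟩, fun s => ?_, fun h hh => ?_⟩
  · simp only [hc]
    exact F.continuous
  · simp only [hc, hφ, hh0]
  · have key : ∀ t s, ((h.conj t).homeo.symm s : ℂ × ℂ) = φ (t, s) := fun t s =>
      h.isShiftFamily.eq_of_eq F (fun t₀ => ⟨M, .of_forall fun t => (hMr t).1⟩) (t₀ := 0)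
        (by simp only [hh s, hφ, hh0]) t
    obtain ⟨d, hd⟩ := h
    have : d = c := funext fun t => ShiftConjugacy.ext_symm fun s => by rw [hc]; exact key t s
    subst this
    rfl

/-! ### Monodromy of symmetric loops -/

theorem symm_half : σ half = half := by
  refine Subtype.ext ?_
  simp only [half, coe_symm_eq]
  norm_num

theorem symmetricLoop_symm {q p : ℝ × ℝ} (α : Path (toComplex q) (toComplex p)) (t : I) :
    symmetricLoop α (σ t) = conjC2 (symmetricLoop α t) := by
  have hσ := coe_symm_eq t
  rw [symmetricLoop, Path.trans_apply, Path.trans_apply]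
  rcases lt_trichotomy (t : ℝ) (1 / 2) with ht | ht | ht
  · rw [dif_neg (by rw [hσ]; linarith), dif_pos ht.le]
    change conjC2 (α (σ _)) = _
    congr 2
    exact Subtype.ext (by simp only [coe_symm_eq]; ring)
  -- At the midpoint both sides are evaluated on the first half of the loop, and they agree because
  -- the endpoint of `α` is real.
  · have e : σ t = t := Subtype.ext (by rw [hσ, ht]; norm_num)
    have e1 : (⟨2 * (t : ℝ), by rw [ht]; norm_num⟩ : I) = 1 := Subtype.ext (by simp [ht])
    rw [e, dif_pos ht.le, e1, α.target, conjC2_toComplex]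
  · rw [dif_pos (by rw [hσ]; linarith), dif_neg (by linarith)]
    change _ = conjC2 (conjC2 (α (σ _)))
    rw [conjC2_conjC2]
    congr 1
    exact Subtype.ext (by simp only [coe_symm_eq]; ring)

theorem symmetricLoop_mem {q p : ℝ × ℝ} (hq : q ∈ DN) {α : Path (toComplex q) (toComplex p)}
    (hα : ∀ t, α t ∈ horseshoeLocus₀) (t : I) : symmetricLoop α t ∈ horseshoeLocus₀ := by
  simp only [symmetricLoop, Path.trans_apply]
  split_ifs with h
  · exact hα _
  · exact conjC2_mem_horseshoeLocus₀ hq (hα _)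

theorem ConjugacyFamily.monodromy_eq_iff {p : ℂ × ℂ} {γ : Path p p} (h : ConjugacyFamily γ)
    (s : Sigma2) : h.monodromy s = s ↔
      ((h.conj 0).homeo.symm s : ℂ × ℂ) = (h.conj 1).homeo.symm s := by
  simp only [ConjugacyFamily.monodromy, Homeomorph.trans_apply]
  rw [← Homeomorph.eq_symm_apply, Subtype.ext_iff]
  rfl

/-- The fixed points of the monodromy of a symmetric loop code the real points. -/
theorem ConjugacyFamily.fixed_iff_real {q p : ℝ × ℝ} (hq : q ∈ DN)
    {α : Path (toComplex q) (toComplex p)} (hα : ∀ t, symmetricLoop α t ∈ horseshoeLocus)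
    (h : ConjugacyFamily (symmetricLoop α)) (s : Sigma2) :
    h.monodromy s = s ↔ conjC2 ((h.conj half).homeo.symm s) = (h.conj half).homeo.symm s := by
  have F := h.isShiftFamily
  set φ : I × Sigma2 → ℂ × ℂ := fun x => ((h.conj x.1).homeo.symm x.2 : ℂ × ℂ) with hφ
  -- The reflected family lies over the same loop by the symmetry of the loop.
  have G : IsShiftFamily (symmetricLoop α) fun x => conjC2 (φ (σ x.1, x.2)) := by
    have := F.conj.comp unitInterval.continuous_symm
    simpa only [symmetricLoop_symm, conjC2_conjC2] using this
  have hyp : ∀ t₀, ∃ M, ∀ᶠ t in nhds t₀, OrbitHyperbolic (symmetricLoop α t) M := by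
    obtain ⟨M, r, hMr⟩ := exists_uniform_constants _ hα
    exact fun t₀ => ⟨M, .of_forall fun t => (hMr t).1⟩
  -- This identifies the value of the reflected family at time `0` with `φ (1, s)`.
  have hreal : conjC2 (φ (1, s)) = φ (1, s) := by
    refine conjC2_eq_of_mem_DN hq ?_
    have := (F.bijOn 1).mapsTo (mem_univ s)
    rwa [Path.target] at this
  rw [h.monodromy_eq_iff]
  change φ (0, s) = φ (1, s) ↔ conjC2 (φ (half, s)) = φ (half, s)
  constructor
  · intro h1
    have := F.eq_of_eq G hyp (s := s) (s' := s) (t₀ := 0) (by simp [hreal, h1]) half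
    simp only [symm_half] at this
    exact this.symm
  · intro h1
    have := F.eq_of_eq G hyp (s := s) (s' := s) (t₀ := half) (by simp [symm_half, h1]) 0
    simpa [hreal] using this

theorem toComplex_re {w : ℂ × ℂ} (hw : conjC2 w = w) : toComplex (w.1.re, w.2.re) = w :=
  Prod.ext (Complex.conj_eq_iff_re.1 (congrArg Prod.fst hw))
    (Complex.conj_eq_iff_re.1 (congrArg Prod.snd hw))

theorem continuous_toComplex : Continuous toComplex := by
  unfold toComplex; fun_prop

theorem ConjugacyFamily.exists_homeomorph_real {q p : ℝ × ℝ} (hq : q ∈ DN)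
    {α : Path (toComplex q) (toComplex p)} (hα : ∀ t, symmetricLoop α t ∈ horseshoeLocus)
    (h : ConjugacyFamily (symmetricLoop α)) :
    ∃ Φ : realK p ≃ₜ Function.fixedPoints h.monodromy,
      (∀ z : realK p, (Φ z : Sigma2) = (h.conj half).homeo (inclHalf (symmetricLoop_half α) z)) ∧
      Function.Semiconj Φ (henonRealK p) h.shiftFix := by
  set ψ := (h.conj half).homeo with hψ
  let ι : realK p → K (symmetricLoop α half) := inclHalf (symmetricLoop_half α)
  have hιc : Continuous ι := (continuous_toComplex.comp continuous_subtype_val).subtype_mk _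
  have hιv : ∀ z, (ι z : ℂ × ℂ) = toComplex z := fun z => rfl
  have hfix : ∀ s, s ∈ Function.fixedPoints h.monodromy ↔
      conjC2 (ψ.symm s) = ψ.symm s := h.fixed_iff_real hq hα
  let Φ : realK p ≃ₜ Function.fixedPoints h.monodromy :=
    { toFun := fun z => ⟨ψ (ι z), (hfix _).2 (by
        rw [Homeomorph.symm_apply_apply, hιv, conjC2_toComplex])⟩
      invFun := fun s => ⟨((ψ.symm s : ℂ × ℂ).1.re, (ψ.symm s : ℂ × ℂ).2.re), by
        change toComplex _ ∈ K (toComplex p)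
        rw [toComplex_re ((hfix s).1 s.2), ← symmetricLoop_half α]
        exact (ψ.symm (s : Sigma2)).2⟩
      left_inv := fun z => by
        refine Subtype.ext ?_
        simp only [Homeomorph.symm_apply_apply, hιv]
        simp [toComplex]
      right_inv := fun s => by
        refine Subtype.ext ?_
        simp only
        rw [← Homeomorph.eq_symm_apply]
        exact Subtype.ext (toComplex_re ((hfix s).1 s.2))
      continuous_toFun := (ψ.continuous.comp hιc).subtype_mk _
      continuous_invFun := by
        refine Continuous.subtype_mk ?_ _
        fun_prop }
  refine ⟨Φ, fun z => rfl, fun z => Subtype.ext ?_⟩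
  have e : ι (henonRealK p z) = henonK _ (ι z) := by
    refine Subtype.ext ?_
    change toComplex (henon p z) = henon (symmetricLoop α half) (toComplex z)
    rw [toComplex_henon, symmetricLoop_half]
  change ψ (ι (henonRealK p z)) = shift (ψ (ι z))
  rw [e]
  exact (h.conj half).semiconj (ι z)

end HenonMonodromy

open HenonMonodromy

theorem theorem3 (a c : ℝ) (hac : toComplex (a, c) ∈ horseshoeLocus₀)
    (q : ℝ × ℝ) (hq : q ∈ DN) :
    -- some loop based at `q` passes through `(a, c)` at time `1/2` and has the property
    (∃ γ : Path (toComplex q) (toComplex q),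
      (∀ t, γ t ∈ horseshoeLocus₀) ∧ γ half = toComplex (a, c) ∧
      ∀ h0 : ShiftConjugacy (toComplex q),
        (∃! h : ConjugacyFamily γ, h.StartsAt h0) ∧
        ∀ h : ConjugacyFamily γ, h.StartsAt h0 →
          ∃ Φ : realK (a, c) ≃ₜ Function.fixedPoints h.monodromy,
            Function.Semiconj Φ (henonRealK (a, c)) h.shiftFix) ∧
    -- every symmetric loop has it, and the conjugacy is the restriction of `h_{1/2}`
    (∀ α : Path (toComplex q) (toComplex (a, c)), (∀ t, α t ∈ horseshoeLocus₀) →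
      (∀ t, symmetricLoop α t ∈ horseshoeLocus₀) ∧
      symmetricLoop α half = toComplex (a, c) ∧
      ∀ h0 : ShiftConjugacy (toComplex q),
        (∃! h : ConjugacyFamily (symmetricLoop α), h.StartsAt h0) ∧
        ∀ h : ConjugacyFamily (symmetricLoop α), h.StartsAt h0 →
          ∃ Φ : realK (a, c) ≃ₜ Function.fixedPoints h.monodromy,
            (∀ z : realK (a, c),
              (Φ z : Sigma2) = (h.conj half).homeo (inclHalf (symmetricLoop_half α) z)) ∧
            Function.Semiconj Φ (henonRealK (a, c)) h.shiftFix) := by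
  have key : ∀ α : Path (toComplex q) (toComplex (a, c)), (∀ t, α t ∈ horseshoeLocus₀) →
      (∀ t, symmetricLoop α t ∈ horseshoeLocus₀) ∧
      symmetricLoop α half = toComplex (a, c) ∧
      ∀ h0 : ShiftConjugacy (toComplex q),
        (∃! h : ConjugacyFamily (symmetricLoop α), h.StartsAt h0) ∧
        ∀ h : ConjugacyFamily (symmetricLoop α), h.StartsAt h0 →
          ∃ Φ : realK (a, c) ≃ₜ Function.fixedPoints h.monodromy,
            (∀ z : realK (a, c),
              (Φ z : Sigma2) = (h.conj half).homeo (inclHalf (symmetricLoop_half α) z)) ∧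
            Function.Semiconj Φ (henonRealK (a, c)) h.shiftFix := by
    intro α hα
    have hmem := symmetricLoop_mem hq hα
    have hmem' := fun t => horseshoeLocus₀_subset (hmem t)
    exact ⟨hmem, symmetricLoop_half α, fun h0 => ⟨existsUnique_conjugacyFamily _ hmem' h0,
      fun h _ => h.exists_homeomorph_real hq hmem'⟩⟩
  refine ⟨?_, key⟩
  -- A component of an open set is path connected, so some path `α` exists, and its symmetric loop
  -- serves for the first claim.
  obtain ⟨α, hα⟩ := exists_path hq hac
  obtain ⟨h1, h2, h3⟩ := key α hα
  refine ⟨symmetricLoop α, h1, h2, fun h0 => ⟨(h3 h0).1, fun h hh => ?_⟩⟩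
  obtain ⟨Φ, -, hΦ⟩ := (h3 h0).2 h hh
  exact ⟨Φ, hΦ⟩
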